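/- Let $\mathcal C(x)=4|x-\tfrac12|-1$ and $\mathcal S(x)=\bigl|2-4|x-\tfrac14|\bigr|-1$ for $x\in[0,1)$, extended to $\mathbb R$ with period one, let $\mathcal C_k(x)=\mathcal C(kx)$, $\mathcal S_k(x)=\mathcal S(kx)$, and, for $R\in\mathbb N=\{1,2,\dots\}$, $$V_R=\operatorname{span}\bigl(\{1\}\cup\{\mathcal C_k,\mathcal S_k : 1\le k\le R\}\bigr).$$ For $s>1/2$ let $W^s=W^s([0,1])$ be the space of the real functions $f(x)=a_0+\sum_{m\ge1}\bigl(a_m\cos(2\pi mx)+b_m\sin(2\pi mx)\bigr)$, $x\in[0,1]$, with $\|f\|_{W^s}^2=a_0^2+\sum_{m\ge1}m^{2s}(a_m^2+b_m^2)<\infty$ (these series converge absolutely, so $f$ is continuous). Let $1/2<s<1$. There is a constant $C\in\mathbb N$, depending only on $s$, and for every $K\in\mathbb R$ there is a constant $C_K\in\mathbb N$, depending only on $s$ and $K$, such that the following holds for all $R\in\mathbb N$ and all $N\ge2$ with $N\ge C\,R\log R$. If $x_1,\dots,x_N$ are independent and uniformly distributed on $[0,1]$, then, with probability at least $1-C/N^2$,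 for all $f\in W^s$ simultaneously the least squares problem $$\min_{g\in V_R}\ \sum_{i=1}^N|g(x_i)-f(x_i)|^2$$ has exactly one minimizer $\widehat f_N\in V_R$, and for every $2\le p\le\infty$, $$\|f-\widehat f_N\|_{L_p([0,1])}\le C\,R^{-s+1/2-1/p}\,\|f\|_{W^s},$$ and, for every $K\in\mathbb R$ with $N\le K\,R\log R$, $$\|f-\widehat f_N\|_{L_p([0,1])}\le C_K\Bigl(\frac{N}{\log N}\Bigr)^{-s+1/2-1/p}\|f\|_{W^s}.$$ -/

import Mathlib

open MeasureTheory
open scoped ENNReal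

noncomputable section

namespace PLSampling

/-- The piecewise linear cosine: `4 |x - 1/2| - 1` on `[0,1)`, extended with period one. -/
def hatCos (x : ℝ) : ℝ := 4 * |Int.fract x - 1 / 2| - 1

/-- The piecewise linear sine: `|2 - 4 |x - 1/4|| - 1` on `[0,1)`, extended with period one. -/
def hatSin (x : ℝ) : ℝ := abs (2 - 4 * |Int.fract x - 1 / 4|) - 1

/-- `V_R`, the span of the constant function `1` and of the dilates
`x ↦ hatCos (k x)`, `x ↦ hatSin (k x)` with `1 ≤ k ≤ R`. -/
def hatSpace (R : ℕ) : Submodule ℝ (ℝ → ℝ) :=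
  Submodule.span ℝ
    ({fun _ => 1} ∪
      {g | ∃ k : ℕ, 1 ≤ k ∧ k ≤ R ∧
        (g = (fun x => hatCos (k * x)) ∨ g = (fun x => hatSin (k * x)))})

/-- `a_0`, the mean of `f` over `[0,1]`. -/
def meanCoeff (f : ℝ → ℝ) : ℝ := ∫ x in (0 : ℝ)..1, f x

/-- `a_m` for `m ≥ 1`. -/
def cosCoeff (f : ℝ → ℝ) (m : ℕ) : ℝ :=
  2 * ∫ x in (0 : ℝ)..1, f x * Real.cos (2 * Real.pi * m * x)

/-- `b_m` for `m ≥ 1`. -/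
def sinCoeff (f : ℝ → ℝ) (m : ℕ) : ℝ :=
  2 * ∫ x in (0 : ℝ)..1, f x * Real.sin (2 * Real.pi * m * x)

/-- The term `m ^ (2 s) * (a_m ^ 2 + b_m ^ 2)` of the squared Sobolev norm. -/
def sobolevTerm (s : ℝ) (f : ℝ → ℝ) (m : ℕ) : ℝ :=
  (m : ℝ) ^ (2 * s) * (cosCoeff f m ^ 2 + sinCoeff f m ^ 2)

/-- The periodic Sobolev norm of order `s` on `[0,1]`; the sum runs over `m = 1, 2, …`. -/
def sobolevNorm (s : ℝ) (f : ℝ → ℝ) : ℝ :=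
  Real.sqrt (meanCoeff f ^ 2 + ∑' m : ℕ, sobolevTerm s f (m + 1))

/-- Membership in the periodic Sobolev space of order `s > 1/2` on `[0,1]`: `f` is square
integrable, its Sobolev norm is finite, and `f` is given on `[0,1]` by its Fourier series
`a_0 + ∑_{m ≥ 1} (a_m cos (2 π m x) + b_m sin (2 π m x))`. As `s > 1/2`, the series converges
absolutely, and the pointwise identity singles out the continuous representative of the class,
the one whose function values are sampled. Only the values of `f` on `[0,1]` matter. -/
structure MemSobolev (s : ℝ) (f : ℝ → ℝ) : Prop where
  memLp : MemLp f 2 (volume.restrict (Set.Icc (0 : ℝ) 1))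
  summable : Summable (fun m : ℕ => sobolevTerm s f (m + 1))
  hasSum : ∀ x ∈ Set.Icc (0 : ℝ) 1,
    HasSum (fun m : ℕ =>
        cosCoeff f (m + 1) * Real.cos (2 * Real.pi * ((m + 1 : ℕ) : ℝ) * x) +
        sinCoeff f (m + 1) * Real.sin (2 * Real.pi * ((m + 1 : ℕ) : ℝ) * x))
      (f x - meanCoeff f)

/-- `g` minimizes `∑ i, |g (x i) - f (x i)| ^ 2` over the space `V`. -/
def IsLeastSquares (V : Submodule ℝ (ℝ → ℝ)) {N : ℕ} (x : Fin N → ℝ) (f g : ℝ → ℝ) : Prop :=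
  g ∈ V ∧ ∀ h ∈ V, ∑ i, |g (x i) - f (x i)| ^ 2 ≤ ∑ i, |h (x i) - f (x i)| ^ 2

/-- The joint law of `N` independent points with the uniform distribution on `[0,1]`. -/
def uniformPoints (N : ℕ) : Measure (Fin N → ℝ) :=
  Measure.pi (fun _ => volume.restrict (Set.Icc (0 : ℝ) 1))

end PLSampling

end

noncomputable section

namespace PLSampling

/-! Up to the factor `π² / 8`, the hats have Fourier series `∑ χ(j) j⁻² cos(2πjx)` with `χ` the
indicator of the odd numbers, and `∑ χ(j) j⁻² sin(2πjx)` with `χ` the character modulo 4. Passing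
from the coefficients `γ`, `δ` of a combination of dilates to its Fourier coefficients is therefore
Dirichlet convolution with `χ(j) j⁻²` (`hasSum_hatPoly`). As `χ` is completely multiplicative, the
inverse is convolution with `μ(j) χ(j) j⁻²`, which is again `O(j⁻²)`. Such a convolution is bounded
on `ℓ²` with weights `n ^ (2 s)` whenever `∑ j ^ (s - 2)` converges, that is for `s < 1`
(`energy_convolution_le`). So the hat system behaves like the trigonometric system: cutting the hat
coefficients of `f` at `R` gives `q ∈ V_R` with the Fourier coefficients of `f` up to `R` and a tail
of controlled energy (`MemSobolev.exists_approx`).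

Randomness enters only through `WellSpread`: by Chernoff's bound, `Q` equal cells all receive about
their expected share of points once `N` is at least a multiple of `Q log N` (`real_wellSpread_ge`).
On such points the sampled square sum of a trigonometric polynomial of degree at most `L` is
comparable with its squared coefficient norm if `Q / L` is large, and the upper bound persists, with
a loss linear in `L / Q`, for any degree (`sampled_trigPoly`). Since `s > 1/2`, these losses are
summable over dyadic blocks, which bounds the samples of a tail (`norm_sample_tail_le`).

For `u ∈ V_R`, split the Fourier series at `m R`. The first `R` frequencies already determine the
coefficients of `u`, and the tail is absorbed when `m` is a large constant; hence samples control
coefficients on `V_R` (`coeffNorm_le_norm_sample`). This gives uniqueness, and applied to `q - f̂`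
it reduces the error of least squares to that of `q`, in `L_2` and in the uniform norm
(`leastSquares_of_wellSpread`). The other `p` follow by interpolation. -/

/-! ### Dirichlet convolution on weighted square-summable sequences -/

/-- The partial weighted energy `∑_{1 ≤ n ≤ M} n ^ (2 s) a_n ^ 2`. -/
def energy (s : ℝ) (a : ℕ → ℝ) (M : ℕ) : ℝ :=
  ∑ n ∈ Finset.Icc 1 M, (n : ℝ) ^ (2 * s) * a n ^ 2

/-- The bound `∑ j, j ^ (s - 2)` for Dirichlet convolution with a sequence `O(j⁻²)`. -/
def dilationConst (s : ℝ) : ℝ := ∑' j : ℕ, (j : ℝ) ^ (s - 2)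

lemma summable_dilation {s : ℝ} (hs : s < 1) : Summable fun j : ℕ => (j : ℝ) ^ (s - 2) :=
  Real.summable_nat_rpow.2 (by linarith)

lemma one_le_dilationConst {s : ℝ} (hs : s < 1) : 1 ≤ dilationConst s := by
  have := (summable_dilation hs).le_tsum 1 (fun j _ => by positivity)
  simpa [dilationConst] using this

/-- Every pair with product at most `M` lies in the box `[1, M]²`, and each pair of the box
contributes to at most one `n`. -/
lemma sum_convolution_le (M : ℕ) (G H : ℕ → ℝ) (hG : ∀ n, 0 ≤ G n) (hH : ∀ n, 0 ≤ H n) :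
    ∑ n ∈ Finset.Icc 1 M, ∑ p ∈ n.divisorsAntidiagonal, G p.1 * H p.2 ≤
      (∑ j ∈ Finset.Icc 1 M, G j) * ∑ m ∈ Finset.Icc 1 M, H m := by
  rw [Finset.sum_mul_sum, ← Finset.sum_product']
  have h1 : ∀ n ∈ Finset.Icc 1 M, ∑ p ∈ n.divisorsAntidiagonal, G p.1 * H p.2 =
      ∑ p ∈ Finset.Icc 1 M ×ˢ Finset.Icc 1 M, if p.1 * p.2 = n then G p.1 * H p.2 else 0 := by
    intro n hn
    rw [← Finset.sum_filter]
    refine Finset.sum_congr ?_ fun _ _ => rfl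
    ext ⟨j, m⟩
    simp only [Nat.mem_divisorsAntidiagonal, Finset.mem_filter, Finset.mem_product,
      Finset.mem_Icc] at hn ⊢
    constructor
    · rintro ⟨rfl, h0⟩
      have hj : 0 < j := Nat.pos_of_ne_zero (by rintro rfl; simp at h0)
      have hm : 0 < m := Nat.pos_of_ne_zero (by rintro rfl; simp at h0)
      exact ⟨⟨⟨hj, (Nat.le_mul_of_pos_right j hm).trans hn.2⟩,
        ⟨hm, (Nat.le_mul_of_pos_left m hj).trans hn.2⟩⟩, rfl⟩
    · rintro ⟨-, rfl⟩
      exact ⟨rfl, by omega⟩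
  rw [Finset.sum_congr rfl h1, Finset.sum_comm]
  refine Finset.sum_le_sum fun p _ => ?_
  rw [Finset.sum_ite_eq]
  split_ifs
  · exact le_rfl
  · exact mul_nonneg (hG _) (hH _)

/-- Dirichlet convolution with a sequence `O(j⁻²)` is bounded for the weights `n ^ (2 s)`. -/
lemma energy_convolution_le {s : ℝ} (hs : s < 1) (w a : ArithmeticFunction ℝ)
    (hw : ∀ j : ℕ, |w j| ≤ (j : ℝ) ^ (-2 : ℝ)) (M : ℕ) :
    energy s (w * a : ArithmeticFunction ℝ) M ≤ dilationConst s ^ 2 * energy s a M := by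
  have hC : ∀ S : Finset ℕ, ∑ j ∈ S, (j : ℝ) ^ (s - 2) ≤ dilationConst s := fun S =>
    (summable_dilation hs).sum_le_tsum S (fun j _ => by positivity)
  have hC0 : 0 ≤ dilationConst s := zero_le_one.trans (one_le_dilationConst hs)
  -- The weight is multiplicative: `n ^ s = j ^ s * m ^ s` when `n = j m`. This makes the estimate
  -- Young's inequality `ℓ¹ * ℓ² ⊆ ℓ²` for `j ^ (s - 2)` and `m ^ s * a m`, obtained from
  -- Cauchy–Schwarz over the divisor pairs of `n`.
  have key : ∀ n ∈ Finset.Icc 1 M, (n : ℝ) ^ (2 * s) * (w * a) n ^ 2 ≤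
      dilationConst s * ∑ p ∈ n.divisorsAntidiagonal,
        (p.1 : ℝ) ^ (s - 2) * ((p.2 : ℝ) ^ (2 * s) * a p.2 ^ 2) := by
    intro n hn
    rw [ArithmeticFunction.mul_apply]
    have e1 : (n : ℝ) ^ (2 * s) * (∑ p ∈ n.divisorsAntidiagonal, w p.1 * a p.2) ^ 2 =
        (∑ p ∈ n.divisorsAntidiagonal, (n : ℝ) ^ s * (w p.1 * a p.2)) ^ 2 := by
      rw [← Finset.mul_sum, mul_pow, ← Real.rpow_natCast ((n : ℝ) ^ s),
        ← Real.rpow_mul (by positivity), mul_comm s]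
      norm_num
    rw [e1]
    refine (Finset.sum_sq_le_sum_mul_sum_of_sq_le_mul _
      (f := fun p : ℕ × ℕ => (p.1 : ℝ) ^ (s - 2))
      (g := fun p : ℕ × ℕ => (p.1 : ℝ) ^ (s - 2) * ((p.2 : ℝ) ^ (2 * s) * a p.2 ^ 2))
      (fun _ _ => by positivity) (fun _ _ => by positivity) ?_).trans ?_
    · rintro ⟨j, m⟩ hp
      simp only [Nat.mem_divisorsAntidiagonal] at hp ⊢
      obtain ⟨rfl, h0⟩ := hp
      have hj : (0 : ℝ) < j := by
        exact_mod_cast Nat.pos_of_ne_zero (by rintro rfl; simp at h0)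
      have e2 : ((j * m : ℕ) : ℝ) ^ s = (j : ℝ) ^ s * (m : ℝ) ^ s := by
        push_cast
        rw [Real.mul_rpow (by positivity) (by positivity)]
      have e3 : (m : ℝ) ^ (2 * s) = ((m : ℝ) ^ s) ^ 2 := by
        rw [← Real.rpow_natCast, ← Real.rpow_mul (by positivity), mul_comm s]
        norm_num
      have e4 : (j : ℝ) ^ (s - 2) = (j : ℝ) ^ s * (j : ℝ) ^ (-2 : ℝ) := by
        rw [← Real.rpow_add hj, sub_eq_add_neg]
      rw [e2, e3, e4]
      have h5 : w j ^ 2 ≤ ((j : ℝ) ^ (-2 : ℝ)) ^ 2 := sq_le_sq' (abs_le.1 (hw j)).1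
        (abs_le.1 (hw j)).2
      have := mul_le_mul_of_nonneg_left h5
        (show 0 ≤ ((j : ℝ) ^ s * (m : ℝ) ^ s * a m) ^ 2 by positivity)
      nlinarith [this]
    · refine mul_le_mul_of_nonneg_right ?_ (Finset.sum_nonneg fun _ _ => by positivity)
      rw [Nat.sum_divisorsAntidiagonal (f := fun i _ => (i : ℝ) ^ (s - 2))]
      exact hC _
  calc energy s (w * a : ArithmeticFunction ℝ) M ≤ ∑ n ∈ Finset.Icc 1 M, dilationConst s *
        ∑ p ∈ n.divisorsAntidiagonal,
          (p.1 : ℝ) ^ (s - 2) * ((p.2 : ℝ) ^ (2 * s) * a p.2 ^ 2) := Finset.sum_le_sum key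
    _ = dilationConst s * ∑ n ∈ Finset.Icc 1 M, ∑ p ∈ n.divisorsAntidiagonal,
          (p.1 : ℝ) ^ (s - 2) * ((p.2 : ℝ) ^ (2 * s) * a p.2 ^ 2) := by rw [Finset.mul_sum]
    _ ≤ dilationConst s * ((∑ j ∈ Finset.Icc 1 M, (j : ℝ) ^ (s - 2)) *
          ∑ m ∈ Finset.Icc 1 M, (m : ℝ) ^ (2 * s) * a m ^ 2) :=
        mul_le_mul_of_nonneg_left (sum_convolution_le M (fun j => (j : ℝ) ^ (s - 2))
          (fun m => (m : ℝ) ^ (2 * s) * a m ^ 2) (fun _ => by positivity)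
          (fun _ => by positivity)) hC0
    _ ≤ dilationConst s * (dilationConst s *
          ∑ m ∈ Finset.Icc 1 M, (m : ℝ) ^ (2 * s) * a m ^ 2) :=
        mul_le_mul_of_nonneg_left (mul_le_mul_of_nonneg_right (hC _)
          (Finset.sum_nonneg fun _ _ => by positivity)) hC0
    _ = dilationConst s ^ 2 * energy s a M := by rw [energy]; ring

/-! ### Completely multiplicative twists and their Dirichlet inverses -/

/-- `χ(j) j⁻²` for a function `χ`, as an arithmetic function. -/
def twist (χ : ℕ →*₀ ℤ) : ArithmeticFunction ℝ where
  toFun j := χ j * ((j : ℝ) ^ 2)⁻¹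
  map_zero' := by simp

lemma twist_apply (χ : ℕ →*₀ ℤ) (j : ℕ) : twist χ j = χ j * ((j : ℝ) ^ 2)⁻¹ := rfl

lemma twist_mul (χ : ℕ →*₀ ℤ) (i j : ℕ) : twist χ (i * j) = twist χ i * twist χ j := by
  simp only [twist_apply, map_mul]
  push_cast
  rw [mul_pow, mul_inv]
  ring

/-- The Dirichlet inverse of `twist χ`. -/
def twistInv (χ : ℕ →*₀ ℤ) : ArithmeticFunction ℝ :=
  ArithmeticFunction.pmul ((ArithmeticFunction.moebius : ArithmeticFunction ℤ) :
    ArithmeticFunction ℝ) (twist χ)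

/-- Complete multiplicativity pulls the common factor `twist χ n` out of the convolution, leaving `ζ
* μ = 1`. -/
lemma twist_mul_twistInv (χ : ℕ →*₀ ℤ) : twist χ * twistInv χ = 1 := by
  ext n
  rcases Nat.eq_zero_or_pos n with rfl | hn
  · simp
  have h : ∑ p ∈ n.divisorsAntidiagonal, (twist χ p.1 * twistInv χ p.2) =
      ∑ p ∈ n.divisorsAntidiagonal, twist χ n *
        ((ArithmeticFunction.zeta : ArithmeticFunction ℝ) p.1 *
          ((ArithmeticFunction.moebius : ArithmeticFunction ℤ) : ArithmeticFunction ℝ) p.2) := by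
    refine Finset.sum_congr rfl fun p hp => ?_
    obtain ⟨hp, h0⟩ := Nat.mem_divisorsAntidiagonal.1 hp
    have : p.1 ≠ 0 := by rintro h; simp [h] at hp; omega
    rw [twistInv, ArithmeticFunction.pmul_apply, ← hp, twist_mul,
      ArithmeticFunction.natCoe_apply, ArithmeticFunction.zeta_apply_ne this]
    push_cast
    ring
  rw [ArithmeticFunction.mul_apply, h, ← Finset.mul_sum, ← ArithmeticFunction.mul_apply,
    ArithmeticFunction.coe_zeta_mul_coe_moebius, ArithmeticFunction.one_apply]
  split_ifs with h1
  · subst h1; simp [twist_apply]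
  · simp

lemma abs_twist_le (χ : ℕ →*₀ ℤ) (hχ : ∀ j, |χ j| ≤ 1) (j : ℕ) :
    |twist χ j| ≤ (j : ℝ) ^ (-2 : ℝ) := by
  have h1 : |(χ j : ℝ)| ≤ 1 := by exact_mod_cast hχ j
  rw [twist_apply, abs_mul, abs_of_nonneg (by positivity : (0 : ℝ) ≤ ((j : ℝ) ^ 2)⁻¹),
    Real.rpow_neg (by positivity), Real.rpow_two]
  exact mul_le_of_le_one_left (by positivity) h1

lemma abs_twistInv_le (χ : ℕ →*₀ ℤ) (hχ : ∀ j, |χ j| ≤ 1) (j : ℕ) :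
    |twistInv χ j| ≤ (j : ℝ) ^ (-2 : ℝ) := by
  rw [twistInv, ArithmeticFunction.pmul_apply, abs_mul]
  refine (mul_le_of_le_one_left (abs_nonneg _) ?_).trans (abs_twist_le χ hχ j)
  rw [ArithmeticFunction.intCoe_apply]
  exact_mod_cast ArithmeticFunction.abs_moebius_le_one

/-- The indicator of the odd numbers. -/
def oddInd : ℕ →*₀ ℤ where
  toFun n := if n % 2 = 1 then 1 else 0
  map_zero' := by simp
  map_one' := by simp
  map_mul' a b := by
    rcases Nat.mod_two_eq_zero_or_one a with h | h <;>
    rcases Nat.mod_two_eq_zero_or_one b with h' | h' <;> simp [Nat.mul_mod, h, h']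

/-- The nontrivial character modulo 4 on the natural numbers. -/
def oddSign : ℕ →*₀ ℤ where
  toFun n := ZMod.χ₄ n
  map_zero' := by simp
  map_one' := by simp
  map_mul' a b := by push_cast; exact map_mul _ _ _

lemma abs_oddInd_le (j : ℕ) : |oddInd j| ≤ 1 := by
  change |if j % 2 = 1 then (1 : ℤ) else 0| ≤ 1
  split_ifs <;> simp

lemma abs_oddSign_le (j : ℕ) : |oddSign j| ≤ 1 := by
  change |ZMod.χ₄ (j : ZMod 4)| ≤ 1
  generalize (j : ZMod 4) = z
  revert z
  decide

/-! ### Fourier series of the hat functions -/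

/-- The full cosine series with coefficients `n⁻²` is the Bernoulli polynomial of degree 2; removing
the even frequencies cancels the quadratic term and leaves a linear function. -/
lemma hasSum_twist_oddInd_of_mem {x : ℝ} (hx : x ∈ Set.Icc (0 : ℝ) (1 / 2)) :
    HasSum (fun j : ℕ => twist oddInd j * Real.cos (2 * Real.pi * j * x))
      (Real.pi ^ 2 / 8 * (1 - 4 * x)) := by
  have B : ∀ y ∈ Set.Icc (0 : ℝ) 1, HasSum (fun n : ℕ => 1 / (n : ℝ) ^ 2 *
      Real.cos (2 * Real.pi * n * y)) (Real.pi ^ 2 * (y ^ 2 - y + 1 / 6)) := by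
    intro y hy
    have := hasSum_one_div_nat_pow_mul_cos (k := 1) one_ne_zero hy
    convert this using 1
    have hb : (Polynomial.map (algebraMap ℚ ℝ) (Polynomial.bernoulli 2)).eval y =
        y ^ 2 - y + 1 / 6 := by
      simp [Polynomial.bernoulli, Finset.sum_range_succ, bernoulli_two, bernoulli_one]
      ring
    simp only [mul_one, hb, Nat.factorial]
    push_cast
    ring
  have h1 := B x ⟨hx.1, by linarith [hx.2]⟩
  have h2 := (B (2 * x) ⟨by linarith [hx.1], by linarith [hx.2]⟩).mul_left (1 / 4)
  have hinj : Function.Injective fun n : ℕ => 2 * n := fun a b h => by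
    simpa using h
  -- The even part is a quarter of the full series at `2 x`, which is why `x` is confined to `[0,
  -- 1/2]`.
  have h3 : HasSum (fun n : ℕ => if n % 2 = 0 then 1 / (n : ℝ) ^ 2 *
      Real.cos (2 * Real.pi * n * x) else 0)
      (1 / 4 * (Real.pi ^ 2 * ((2 * x) ^ 2 - 2 * x + 1 / 6))) := by
    rw [← hinj.hasSum_iff]
    · refine h2.congr_fun fun n => ?_
      simp only [Function.comp_apply, Nat.mul_mod_right, if_true]
      push_cast
      rw [show 2 * Real.pi * (2 * (n : ℝ)) * x = 2 * Real.pi * n * (2 * x) by ring]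
      by_cases hn : (n : ℝ) = 0
      · simp [hn]
      · field_simp
        ring_nf
    · intro n hn
      rw [if_neg]
      intro h
      exact hn ⟨n / 2, by simp only; omega⟩
  rw [show Real.pi ^ 2 / 8 * (1 - 4 * x) = Real.pi ^ 2 * (x ^ 2 - x + 1 / 6) -
    1 / 4 * (Real.pi ^ 2 * ((2 * x) ^ 2 - 2 * x + 1 / 6)) by ring]
  refine (h1.sub h3).congr_fun fun n => ?_
  have : (oddInd n : ℤ) = if n % 2 = 1 then 1 else 0 := rfl
  rw [twist_apply, this]
  rcases Nat.mod_two_eq_zero_or_one n with h | h <;> simp [h]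

lemma hasSum_hatCos (x : ℝ) :
    HasSum (fun j : ℕ => twist oddInd j * Real.cos (2 * Real.pi * j * x))
      (Real.pi ^ 2 / 8 * hatCos x) := by
  have hper : ∀ (y : ℝ) (j : ℕ), Real.cos (2 * Real.pi * j * Int.fract y) =
      Real.cos (2 * Real.pi * j * y) := by
    intro y j
    rw [Int.fract, show 2 * Real.pi * (j : ℝ) * (y - ⌊y⌋) =
      2 * Real.pi * j * y - ((j * ⌊y⌋ : ℤ) : ℝ) * (2 * Real.pi) by push_cast; ring,
      Real.cos_sub_int_mul_two_pi]
  simp_rw [← hper x]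
  rw [hatCos]
  have h0 := Int.fract_nonneg x
  have h1 := (Int.fract_lt_one x).le
  set t := Int.fract x
  rcases le_total t (1 / 2) with h | h
  · rw [abs_of_nonpos (by linarith)]
    convert hasSum_twist_oddInd_of_mem ⟨h0, h⟩ using 1
    ring
  · rw [abs_of_nonneg (by linarith)]
    convert hasSum_twist_oddInd_of_mem (x := 1 - t) ⟨by linarith, by linarith⟩ using 1
    · ext j
      rw [show 2 * Real.pi * (j : ℝ) * (1 - t) = (j : ℝ) * (2 * Real.pi) - 2 * Real.pi * j * t
        by ring, Real.cos_nat_mul_two_pi_sub]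
    · ring

lemma hatSin_eq (x : ℝ) : hatSin x = hatCos (x - 1 / 4) := by
  rw [hatSin, hatCos]
  have h0 := Int.fract_nonneg x
  have h1 := Int.fract_lt_one x
  have hx : x - 1 / 4 = (Int.fract x - 1 / 4) + (⌊x⌋ : ℤ) := by
    linarith [Int.fract_add_floor x]
  rw [hx, Int.fract_add_intCast]
  set t := Int.fract x
  rcases le_or_gt (1 / 4) t with h | h
  · rw [Int.fract_eq_self.2 ⟨by linarith, by linarith⟩, abs_of_nonneg (by linarith : 0 ≤ t - 1 / 4),
      ← abs_neg, show -(2 - 4 * (t - 1 / 4)) = 4 * (t - 1 / 4 - 1 / 2) by ring, abs_mul]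
    norm_num
  · have : Int.fract (t - 1 / 4) = t + 3 / 4 := by
      rw [← Int.fract_add_one, Int.fract_eq_self.2 ⟨by linarith, by linarith⟩]
      ring
    rw [this, abs_of_nonpos (by linarith : t - 1 / 4 ≤ 0), abs_of_nonneg (by linarith),
      abs_of_nonneg (by linarith)]
    ring

/-- The sine hat is the cosine hat shifted by `1/4`. For odd `j` the shift turns `cos(2πjx)` into `±
sin(2πjx)`, the sign being the character modulo 4. -/
lemma hasSum_hatSin (x : ℝ) :
    HasSum (fun j : ℕ => twist oddSign j * Real.sin (2 * Real.pi * j * x))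
      (Real.pi ^ 2 / 8 * hatSin x) := by
  rw [hatSin_eq]
  convert hasSum_hatCos (x - 1 / 4) using 1
  ext j
  rw [twist_apply, twist_apply]
  have e1 : (oddSign j : ℤ) = ZMod.χ₄ (j : ZMod 4) := rfl
  have e2 : (oddInd j : ℤ) = if j % 2 = 1 then 1 else 0 := rfl
  rw [e1, e2, ZMod.χ₄_nat_eq_if_mod_four]
  obtain ⟨k, hk⟩ : ∃ k, j = 4 * k + j % 4 := ⟨j / 4, by omega⟩
  have h4 : j % 4 < 4 := Nat.mod_lt _ (by norm_num)
  generalize j % 4 = r at hk h4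
  interval_cases r
  · have : j % 2 = 0 := by omega
    simp [this]
  · have a1 : j % 2 = 1 := by omega
    have a2 : j % 4 = 1 := by omega
    have : 2 * Real.pi * (j : ℝ) * (x - 1 / 4) =
        2 * Real.pi * j * x - Real.pi / 2 - k * (2 * Real.pi) := by
      rw [hk]; push_cast; ring
    rw [this, Real.cos_sub_nat_mul_two_pi, Real.cos_sub_pi_div_two]
    simp [a1]
  · have : j % 2 = 0 := by omega
    simp [this]
  · have a1 : j % 2 = 1 := by omega
    have a2 : j % 4 = 3 := by omega
    have : 2 * Real.pi * (j : ℝ) * (x - 1 / 4) =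
        2 * Real.pi * j * x + Real.pi / 2 - ((k + 1 : ℕ) : ℝ) * (2 * Real.pi) := by
      rw [hk]; push_cast; ring
    rw [this, Real.cos_sub_nat_mul_two_pi, Real.cos_add_pi_div_two]
    simp [a1]

/-! ### Trigonometric polynomials: orthogonality and local oscillation -/

/-- The trigonometric polynomial with frequencies in `S` and coefficients `a`, `b`. -/
def trigPoly (S : Finset ℕ) (a b : ℕ → ℝ) (x : ℝ) : ℝ :=
  ∑ n ∈ S, (a n * Real.cos (2 * Real.pi * n * x) + b n * Real.sin (2 * Real.pi * n * x))

lemma continuous_trigPoly (S : Finset ℕ) (a b : ℕ → ℝ) : Continuous (trigPoly S a b) := by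
  unfold trigPoly
  fun_prop

lemma hasDerivAt_trigPoly (S : Finset ℕ) (a b : ℕ → ℝ) (x : ℝ) :
    HasDerivAt (trigPoly S a b)
      (trigPoly S (fun n => 2 * Real.pi * n * b n) (fun n => -(2 * Real.pi * n * a n)) x) x := by
  unfold trigPoly
  refine HasDerivAt.fun_sum fun n _ => ?_
  have h : HasDerivAt (fun y : ℝ => 2 * Real.pi * n * y) (2 * Real.pi * n) x := by
    simpa using (hasDerivAt_id x).const_mul (2 * Real.pi * n)
  have h' := (h.cos.const_mul (a n)).add (h.sin.const_mul (b n))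
  refine h'.congr_deriv ?_
  ring

lemma integral_cos_int (k : ℤ) :
    ∫ x in (0 : ℝ)..1, Real.cos (2 * Real.pi * k * x) = if k = 0 then 1 else 0 := by
  split_ifs with h
  · simp [h]
  · have hk : 2 * Real.pi * (k : ℝ) ≠ 0 := by positivity
    rw [intervalIntegral.integral_comp_mul_left _ hk, integral_cos]
    have : Real.sin (2 * Real.pi * k) = 0 := by
      rw [show 2 * Real.pi * (k : ℝ) = ((2 * k : ℤ) : ℝ) * Real.pi by push_cast; ring]
      exact Real.sin_int_mul_pi _
    simp [this]

lemma integral_sin_int (k : ℤ) :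
    ∫ x in (0 : ℝ)..1, Real.sin (2 * Real.pi * k * x) = 0 := by
  by_cases h : k = 0
  · simp [h]
  · have hk : 2 * Real.pi * (k : ℝ) ≠ 0 := by positivity
    rw [intervalIntegral.integral_comp_mul_left _ hk, integral_sin]
    have : Real.cos (2 * Real.pi * k) = 1 := by
      rw [mul_comm]
      exact Real.cos_int_mul_two_pi _
    simp [this]

/-- Product-to-sum formulas. The second term is felt only at `m = n = 0`, where the cosine has mean
square 1 and the sine vanishes. -/
lemma integral_trig_mul (a b c d : ℝ) (m n : ℕ) :
    ∫ x in (0 : ℝ)..1,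
      (a * Real.cos (2 * Real.pi * m * x) + b * Real.sin (2 * Real.pi * m * x)) *
        (c * Real.cos (2 * Real.pi * n * x) + d * Real.sin (2 * Real.pi * n * x)) =
      (if m = n then (a * c + b * d) / 2 else 0) +
        if m + n = 0 then (a * c - b * d) / 2 else 0 := by
  have e : ∀ x : ℝ,
      (a * Real.cos (2 * Real.pi * m * x) + b * Real.sin (2 * Real.pi * m * x)) *
        (c * Real.cos (2 * Real.pi * n * x) + d * Real.sin (2 * Real.pi * n * x)) =
      (a * c + b * d) / 2 * Real.cos (2 * Real.pi * ((m - n : ℤ) : ℝ) * x) +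
      (a * c - b * d) / 2 * Real.cos (2 * Real.pi * ((m + n : ℤ) : ℝ) * x) +
      (b * c - a * d) / 2 * Real.sin (2 * Real.pi * ((m - n : ℤ) : ℝ) * x) +
      (a * d + b * c) / 2 * Real.sin (2 * Real.pi * ((m + n : ℤ) : ℝ) * x) := by
    intro x
    push_cast
    rw [show 2 * Real.pi * ((m : ℝ) - n) * x = 2 * Real.pi * m * x - 2 * Real.pi * n * x by ring,
      show 2 * Real.pi * ((m : ℝ) + n) * x = 2 * Real.pi * m * x + 2 * Real.pi * n * x by ring,
      Real.cos_sub, Real.cos_add, Real.sin_sub, Real.sin_add]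
    ring
  simp_rw [e]
  rw [intervalIntegral.integral_add, intervalIntegral.integral_add, intervalIntegral.integral_add]
  · simp only [intervalIntegral.integral_const_mul, integral_cos_int, integral_sin_int]
    have h1 : ((m : ℤ) - n = 0) ↔ m = n := by omega
    have h2 : ((m : ℤ) + n = 0) ↔ m + n = 0 := by omega
    simp only [h1, h2]
    split_ifs <;> ring
  all_goals exact Continuous.intervalIntegrable (by fun_prop) _ _

lemma integral_trigPoly_sq (S : Finset ℕ) (a b : ℕ → ℝ) :
    ∫ x in (0 : ℝ)..1, trigPoly S a b x ^ 2 =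
      ∑ n ∈ S, ((a n ^ 2 + b n ^ 2) / 2 + if n = 0 then (a n ^ 2 - b n ^ 2) / 2 else 0) := by
  simp only [trigPoly, sq, Finset.sum_mul_sum]
  rw [intervalIntegral.integral_finsetSum
    (fun _ _ => Continuous.intervalIntegrable (by fun_prop) _ _)]
  refine Finset.sum_congr rfl fun m hm => ?_
  rw [intervalIntegral.integral_finsetSum
    (fun _ _ => Continuous.intervalIntegrable (by fun_prop) _ _)]
  simp_rw [integral_trig_mul]
  rw [Finset.sum_add_distrib, Finset.sum_ite_eq, if_pos hm]
  congr 1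
  rw [Finset.sum_eq_single_of_mem m hm]
  · by_cases h : m = 0 <;> simp [h]
  · intro n _ hne
    rw [if_neg (by omega)]

lemma integral_trigPoly_sq_le (S : Finset ℕ) (a b : ℕ → ℝ) :
    ∫ x in (0 : ℝ)..1, trigPoly S a b x ^ 2 ≤ ∑ n ∈ S, (a n ^ 2 + b n ^ 2) := by
  rw [integral_trigPoly_sq]
  refine Finset.sum_le_sum fun n _ => ?_
  split_ifs <;> nlinarith [sq_nonneg (a n), sq_nonneg (b n)]

/-- The coefficient `b 0` multiplies `sin 0`, so it cannot be recovered from the function and has to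
vanish. -/
lemma le_integral_trigPoly_sq (S : Finset ℕ) (a b : ℕ → ℝ) (hb : b 0 = 0) :
    (∑ n ∈ S, (a n ^ 2 + b n ^ 2)) / 2 ≤ ∫ x in (0 : ℝ)..1, trigPoly S a b x ^ 2 := by
  rw [integral_trigPoly_sq, Finset.sum_div]
  refine Finset.sum_le_sum fun n _ => ?_
  split_ifs with h
  · subst h; rw [hb]; nlinarith [sq_nonneg (a 0)]
  · simp

/-- Bernstein's inequality in `L_2`, read off the coefficients, combined with the inequality of
arithmetic and geometric means. -/
lemma two_integral_abs_mul_deriv_le (S : Finset ℕ) (a b : ℕ → ℝ) (L : ℕ) (hL : ∀ n ∈ S, n ≤ L) :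
    ∫ x in (0 : ℝ)..1, 2 * |trigPoly S a b x *
      trigPoly S (fun n => 2 * Real.pi * n * b n) (fun n => -(2 * Real.pi * n * a n)) x| ≤
      4 * Real.pi * L * ∑ n ∈ S, (a n ^ 2 + b n ^ 2) := by
  set h := trigPoly S a b with hh
  set k := trigPoly S (fun n => 2 * Real.pi * n * b n) (fun n => -(2 * Real.pi * n * a n)) with hk
  have ch : Continuous h := continuous_trigPoly _ _ _
  have ck : Continuous k := continuous_trigPoly _ _ _
  have hA : 0 ≤ ∑ n ∈ S, (a n ^ 2 + b n ^ 2) := Finset.sum_nonneg fun _ _ => by positivity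
  have h1 : ∫ x in (0 : ℝ)..1, h x ^ 2 ≤ ∑ n ∈ S, (a n ^ 2 + b n ^ 2) :=
    integral_trigPoly_sq_le _ _ _
  have h2 : ∫ x in (0 : ℝ)..1, k x ^ 2 ≤
      (2 * Real.pi * L) ^ 2 * ∑ n ∈ S, (a n ^ 2 + b n ^ 2) := by
    refine (integral_trigPoly_sq_le _ _ _).trans ?_
    rw [Finset.mul_sum]
    refine Finset.sum_le_sum fun n hn => ?_
    have : (2 * Real.pi * n) ^ 2 ≤ (2 * Real.pi * L) ^ 2 := by
      have : (n : ℝ) ≤ L := by exact_mod_cast hL n hn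
      gcongr
    have := mul_le_mul_of_nonneg_right this (show 0 ≤ a n ^ 2 + b n ^ 2 by positivity)
    nlinarith [this]
  rcases Nat.eq_zero_or_pos L with rfl | hLpos
  · have hk0 : ∀ x, k x = 0 := by
      intro x
      rw [hk, trigPoly]
      refine Finset.sum_eq_zero fun n hn => ?_
      have : n = 0 := by simpa using hL n hn
      simp [this]
    simp [hk0]
  -- This weight balances `t h² + t⁻¹ h'²`, since differentiation costs at most the factor `2πL`; `L
  -- = 0` is treated apart because of the division.
  set t : ℝ := 2 * Real.pi * L with ht
  have ht0 : 0 < t := by positivity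
  have h3 : ∫ x in (0 : ℝ)..1, 2 * |h x * k x| ≤
      ∫ x in (0 : ℝ)..1, (t * h x ^ 2 + t⁻¹ * k x ^ 2) := by
    refine intervalIntegral.integral_mono_on zero_le_one
      (Continuous.intervalIntegrable (by fun_prop) _ _)
      (Continuous.intervalIntegrable (by fun_prop) _ _) fun x _ => ?_
    have e : t * h x ^ 2 + t⁻¹ * k x ^ 2 = t⁻¹ * ((t * |h x|) ^ 2 + |k x| ^ 2) := by
      rw [mul_pow, sq_abs, sq_abs]
      field_simp
    have e' : 2 * |h x * k x| = t⁻¹ * (2 * (t * |h x|) * |k x|) := by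
      rw [abs_mul]
      field_simp
    rw [e, e']
    exact mul_le_mul_of_nonneg_left (two_mul_le_add_sq _ _) (by positivity)
  refine h3.trans ?_
  rw [intervalIntegral.integral_add (Continuous.intervalIntegrable (by fun_prop) _ _)
    (Continuous.intervalIntegrable (by fun_prop) _ _), intervalIntegral.integral_const_mul,
    intervalIntegral.integral_const_mul]
  have h4 := mul_le_mul_of_nonneg_left h1 ht0.le
  have h5 := mul_le_mul_of_nonneg_left h2 (inv_pos.2 ht0).le
  have h6 : t⁻¹ * (t ^ 2 * ∑ n ∈ S, (a n ^ 2 + b n ^ 2)) = t * ∑ n ∈ S, (a n ^ 2 + b n ^ 2) := by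
    field_simp
  have h7 : 4 * Real.pi * L = t + t := by rw [ht]; ring
  rw [h7, add_mul]
  linarith

/-- On an interval, a squared `C¹` function differs from its mean by at most `∫ 2 |h h'|`. -/
lemma abs_sq_sub_average_le {h k : ℝ → ℝ} (hd : ∀ x, HasDerivAt h (k x) x) (hk : Continuous k)
    {u v q x : ℝ} (hq : 0 < q) (huv : v - u = q⁻¹) (hx : x ∈ Set.Icc u v) :
    |h x ^ 2 - q * ∫ y in u..v, h y ^ 2| ≤ ∫ y in u..v, 2 * |h y * k y| := by
  have ch : Continuous h := continuous_iff_continuousAt.2 fun x => (hd x).continuousAt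
  have huv' : u ≤ v := by linarith [hx.1, hx.2]
  set β := ∫ y in u..v, 2 * |h y * k y| with hβ
  have hc : Continuous fun y => 2 * |h y * k y| := by fun_prop
  -- The fundamental theorem of calculus for `h²`, whose derivative is `2 h h'`.
  have key : ∀ y ∈ Set.Icc u v, |h x ^ 2 - h y ^ 2| ≤ β := by
    intro y hy
    have e : ∫ z in y..x, 2 * (h z * k z) = h x ^ 2 - h y ^ 2 := by
      refine intervalIntegral.integral_eq_sub_of_hasDerivAt (f := fun z => h z ^ 2)
        (fun z _ => ?_) (Continuous.intervalIntegrable (by fun_prop) _ _)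
      refine ((hd z).pow 2).congr_deriv ?_
      push_cast
      ring
    have h1 := intervalIntegral.norm_integral_le_abs_integral_norm
      (f := fun z => 2 * (h z * k z)) (a := y) (b := x) (μ := volume)
    rw [e] at h1
    have h2 : (fun z => ‖2 * (h z * k z)‖) = fun z => 2 * |h z * k z| := by
      ext z
      rw [norm_mul, Real.norm_eq_abs, Real.norm_eq_abs, abs_two]
    rw [Real.norm_eq_abs, h2] at h1
    refine h1.trans ?_
    refine (intervalIntegral.abs_integral_mono_interval (c := u) (d := v) ?_ ?_
      (hc.intervalIntegrable _ _)).trans ?_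
    · rw [Set.uIoc_of_le huv']
      intro z hz
      rcases Set.mem_uIoc.1 hz with h | h
      · exact ⟨hy.1.trans_lt h.1, h.2.trans hx.2⟩
      · exact ⟨hx.1.trans_lt h.1, h.2.trans hy.2⟩
    · exact Filter.Eventually.of_forall fun z => by positivity
    · rw [abs_of_nonneg]
      exact intervalIntegral.integral_nonneg huv' fun z _ => by positivity
  have e : h x ^ 2 - q * ∫ y in u..v, h y ^ 2 = q * ∫ y in u..v, (h x ^ 2 - h y ^ 2) := by
    rw [intervalIntegral.integral_sub (Continuous.intervalIntegrable (by fun_prop) _ _)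
      (Continuous.intervalIntegrable (by fun_prop) _ _), intervalIntegral.integral_const, huv,
      smul_eq_mul]
    field_simp
  rw [e, abs_mul, abs_of_pos hq]
  have := intervalIntegral.norm_integral_le_of_norm_le_const (a := u) (b := v)
    (f := fun y => h x ^ 2 - h y ^ 2) (C := β) fun y hy => by
      rw [Set.uIoc_of_le huv'] at hy
      exact key y ⟨hy.1.le, hy.2⟩
  rw [Real.norm_eq_abs, huv, abs_of_pos (inv_pos.2 hq)] at this
  calc q * |∫ y in u..v, (h x ^ 2 - h y ^ 2)| ≤ q * (β * q⁻¹) :=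
        mul_le_mul_of_nonneg_left this hq.le
    _ = β := by field_simp

/-! ### Sampling trigonometric polynomials on well-spread points -/

/-- The points of `x` lie in `[0,1)`, and each of the `Q` cells `[j/Q, (j+1)/Q)` holds its
expected share of them up to the factors `1/4` and `3`. -/
def WellSpread {N : ℕ} (Q : ℕ) (x : Fin N → ℝ) : Prop :=
  (∀ i, x i ∈ Set.Ico (0 : ℝ) 1) ∧ ∀ j < Q,
    (N : ℝ) / (4 * Q) ≤ ∑ i, (Set.Ico ((j : ℝ) / Q) ((j + 1 : ℝ) / Q)).indicator 1 (x i) ∧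
    ∑ i, (Set.Ico ((j : ℝ) / Q) ((j + 1 : ℝ) / Q)).indicator 1 (x i) ≤ 3 * (N : ℝ) / Q

lemma mem_cell_iff {Q : ℕ} (hQ : 0 < Q) {t : ℝ} (ht : 0 ≤ t) (j : ℕ) :
    t ∈ Set.Ico ((j : ℝ) / Q) ((j + 1 : ℝ) / Q) ↔ ⌊Q * t⌋₊ = j := by
  have hQ' : (0 : ℝ) < Q := by exact_mod_cast hQ
  rw [Nat.floor_eq_iff (by positivity), Set.mem_Ico, div_le_iff₀ hQ', lt_div_iff₀ hQ', mul_comm t]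

lemma sum_eq_sum_cells {N Q : ℕ} (hQ : 0 < Q) {x : Fin N → ℝ}
    (hx : ∀ i, x i ∈ Set.Ico (0 : ℝ) 1) (F : Fin N → ℝ) :
    ∑ i, F i = ∑ j ∈ Finset.range Q,
      ∑ i, (Set.Ico ((j : ℝ) / Q) ((j + 1 : ℝ) / Q)).indicator 1 (x i) * F i := by
  have hQ' : (0 : ℝ) < Q := by exact_mod_cast hQ
  rw [Finset.sum_comm]
  refine Finset.sum_congr rfl fun i _ => ?_
  rw [Finset.sum_eq_single_of_mem ⌊Q * x i⌋₊]
  · rw [Set.indicator_of_mem ((mem_cell_iff hQ (hx i).1 _).2 rfl)]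
    simp
  · rw [Finset.mem_range, Nat.floor_lt (by have := (hx i).1; positivity)]
    nlinarith [(hx i).2]
  · intro j _ hj
    rw [Set.indicator_of_notMem (fun h => hj ((mem_cell_iff hQ (hx i).1 _).1 h).symm), zero_mul]

/-- On each cell `h²` is replaced by its mean, at a total cost of at most `3N/Q` times `∫ 2|h h'| ≤
4πL ∑ (a² + b²)`; hence `12πL/Q`. The `1/8` is the share `1/4` of a cell times the `1/2` lost
between coefficients and integral. There is no relation between `L` and `Q`: the upper bound is
needed for arbitrarily high frequencies. -/
lemma sampled_trigPoly {N Q : ℕ} (hQ : 0 < Q) {x : Fin N → ℝ} (hx : WellSpread Q x)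
    (S : Finset ℕ) (a b : ℕ → ℝ) (L : ℕ) (hL : ∀ n ∈ S, n ≤ L) :
    (∑ i, trigPoly S a b (x i) ^ 2 ≤
      N * (3 + 12 * Real.pi * L / Q) * ∑ n ∈ S, (a n ^ 2 + b n ^ 2)) ∧
    (b 0 = 0 → N * (1 / 8 - 12 * Real.pi * L / Q) * ∑ n ∈ S, (a n ^ 2 + b n ^ 2) ≤
      ∑ i, trigPoly S a b (x i) ^ 2) := by
  have hQ' : (0 : ℝ) < Q := by exact_mod_cast hQ
  set h := trigPoly S a b with hh
  set k := trigPoly S (fun n => 2 * Real.pi * n * b n) (fun n => -(2 * Real.pi * n * a n)) with hk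
  have ch : Continuous h := continuous_trigPoly _ _ _
  have ck : Continuous k := continuous_trigPoly _ _ _
  set A := ∑ n ∈ S, (a n ^ 2 + b n ^ 2)
  set I : ℕ → Set ℝ := fun j => Set.Ico ((j : ℝ) / Q) ((j + 1 : ℝ) / Q) with hI
  set α : ℕ → ℝ := fun j => Q * ∫ y in ((j : ℝ) / Q)..((j + 1 : ℝ) / Q), h y ^ 2 with hα
  set β : ℕ → ℝ := fun j => ∫ y in ((j : ℝ) / Q)..((j + 1 : ℝ) / Q), 2 * |h y * k y| with hβ
  have hle : ∀ j : ℕ, (j : ℝ) / Q ≤ (j + 1 : ℝ) / Q := fun j => by gcongr; linarith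
  have hα0 : ∀ j, 0 ≤ α j := fun j => mul_nonneg hQ'.le
    (intervalIntegral.integral_nonneg (hle j) fun _ _ => by positivity)
  have hβ0 : ∀ j, 0 ≤ β j := fun j =>
    intervalIntegral.integral_nonneg (hle j) fun _ _ => by positivity
  have adj : ∀ g : ℝ → ℝ, Continuous g →
      ∑ j ∈ Finset.range Q, ∫ y in ((j : ℝ) / Q)..((j + 1 : ℝ) / Q), g y =
        ∫ y in (0 : ℝ)..1, g y := by
    intro g hg
    have := intervalIntegral.sum_integral_adjacent_intervals (f := g) (μ := volume)
      (a := fun j : ℕ => (j : ℝ) / Q) (n := Q) fun _ _ => hg.intervalIntegrable _ _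
    simpa [hQ'.ne'] using this
  have hαs : ∑ j ∈ Finset.range Q, α j = Q * ∫ y in (0 : ℝ)..1, h y ^ 2 := by
    rw [← Finset.mul_sum, adj _ (by fun_prop)]
  have hβs : ∑ j ∈ Finset.range Q, β j ≤ 4 * Real.pi * L * A := by
    rw [adj _ (by fun_prop)]
    exact two_integral_abs_mul_deriv_le S a b L hL
  have hcell : ∀ j i, x i ∈ I j → |h (x i) ^ 2 - α j| ≤ β j := fun j i hi =>
    abs_sq_sub_average_le (hasDerivAt_trigPoly S a b) ck hQ' (by field_simp; ring)
      ⟨hi.1, hi.2.le⟩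
  have hind : ∀ j i, 0 ≤ (I j).indicator (1 : ℝ → ℝ) (x i) := fun j i =>
    Set.indicator_nonneg (fun _ _ => zero_le_one) _
  have hsum := sum_eq_sum_cells hQ hx.1 fun i => h (x i) ^ 2
  have hN : (0 : ℝ) ≤ N := N.cast_nonneg
  constructor
  · rw [hsum]
    calc _ ≤ ∑ j ∈ Finset.range Q, 3 * (N : ℝ) / Q * (α j + β j) := by
          refine Finset.sum_le_sum fun j hj => ?_
          refine le_trans (b := ∑ i, (I j).indicator 1 (x i) * (α j + β j)) ?_ ?_
          · refine Finset.sum_le_sum fun i _ => ?_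
            by_cases hi : x i ∈ I j
            · exact mul_le_mul_of_nonneg_left (by linarith [(abs_le.1 (hcell j i hi)).2]) (hind j i)
            · change (I j).indicator 1 (x i) * _ ≤ _
              simp [Set.indicator_of_notMem hi]
          · rw [← Finset.sum_mul]
            exact mul_le_mul_of_nonneg_right (hx.2 j (Finset.mem_range.1 hj)).2
              (add_nonneg (hα0 j) (hβ0 j))
      _ = 3 * (N : ℝ) / Q * (Q * (∫ y in (0 : ℝ)..1, h y ^ 2) + ∑ j ∈ Finset.range Q, β j) := by
          rw [← Finset.mul_sum, Finset.sum_add_distrib, hαs]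
      _ ≤ 3 * (N : ℝ) / Q * (Q * A + 4 * Real.pi * L * A) := by
          gcongr
          exact integral_trigPoly_sq_le S a b
      _ = _ := by field_simp; ring
  · intro hb
    rw [hsum]
    calc N * (1 / 8 - 12 * Real.pi * L / Q) * A
        = (N : ℝ) / (4 * Q) * (Q * (A / 2)) - 3 * (N : ℝ) / Q * (4 * Real.pi * L * A) := by
          field_simp; ring
      _ ≤ (N : ℝ) / (4 * Q) * (Q * ∫ y in (0 : ℝ)..1, h y ^ 2) -
          3 * (N : ℝ) / Q * ∑ j ∈ Finset.range Q, β j := by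
          gcongr
          exact le_integral_trigPoly_sq S a b hb
      _ = ∑ j ∈ Finset.range Q, ((N : ℝ) / (4 * Q) * α j - 3 * (N : ℝ) / Q * β j) := by
          rw [Finset.sum_sub_distrib, ← Finset.mul_sum, ← Finset.mul_sum (f := β),
            hαs]
      _ ≤ _ := by
          refine Finset.sum_le_sum fun j hj => ?_
          refine le_trans (b := ∑ i, (I j).indicator 1 (x i) * (α j - β j)) ?_ ?_
          · rw [← Finset.sum_mul, mul_sub]
            obtain ⟨h1, h2⟩ := hx.2 j (Finset.mem_range.1 hj)
            exact sub_le_sub (mul_le_mul_of_nonneg_right h1 (hα0 j))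
              (mul_le_mul_of_nonneg_right h2 (hβ0 j))
          · refine Finset.sum_le_sum fun i _ => ?_
            by_cases hi : x i ∈ I j
            · exact mul_le_mul_of_nonneg_left (by linarith [(abs_le.1 (hcell j i hi)).1]) (hind j i)
            · change _ ≤ (I j).indicator 1 (x i) * _
              simp [Set.indicator_of_notMem hi]

/-! ### Tails of Fourier series by dyadic blocks -/

lemma norm_le_of_dyadic_blocks {E : Type*} [NormedAddCommGroup E] {τ : ℕ → E} {h : E}
    (hτ : HasSum τ h) {L : ℕ} (hL : 1 ≤ L) (h0 : ∀ n ≤ L, τ n = 0) {B r : ℝ} (hB : 0 ≤ B)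
    (hr : 0 ≤ r) (hr1 : r < 1)
    (hblock : ∀ j : ℕ, ‖∑ n ∈ Finset.Ioc (2 ^ j * L) (2 ^ (j + 1) * L), τ n‖ ≤ B * r ^ j) :
    ‖h‖ ≤ B / (1 - r) := by
  have hpart : ∀ J : ℕ, ‖∑ n ∈ Finset.range (2 ^ J * L + 1), τ n‖ ≤
      ∑ j ∈ Finset.range J, B * r ^ j := by
    intro J
    induction J with
    | zero =>
      rw [Finset.sum_eq_zero fun n hn => h0 n (by simp at hn; omega)]
      simp
    | succ J ih =>
      have hle : 2 ^ J * L ≤ 2 ^ (J + 1) * L :=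
        Nat.mul_le_mul_right _ (Nat.pow_le_pow_right (by norm_num) (by omega))
      have e : ∑ n ∈ Finset.range (2 ^ (J + 1) * L + 1), τ n =
          ∑ n ∈ Finset.range (2 ^ J * L + 1), τ n +
            ∑ n ∈ Finset.Ioc (2 ^ J * L) (2 ^ (J + 1) * L), τ n := by
        rw [← Finset.sum_range_add_sum_Ico τ (Nat.succ_le_succ hle)]
        congr 1
        refine Finset.sum_congr ?_ fun _ _ => rfl
        ext k
        simp only [Finset.mem_Ico, Finset.mem_Ioc]
        omega
      rw [e, Finset.sum_range_succ (fun j => B * r ^ j)]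
      exact (norm_add_le _ _).trans (add_le_add ih (hblock J))
  have hlim : Filter.Tendsto (fun J : ℕ => 2 ^ J * L + 1) Filter.atTop Filter.atTop := by
    refine Filter.tendsto_atTop_mono (fun J => ?_) Filter.tendsto_id
    have : J < 2 ^ J := Nat.lt_two_pow_self
    simp only [id]
    nlinarith
  have ht := ((hτ.tendsto_sum_nat).comp hlim).norm
  refine le_of_tendsto ht (Filter.Eventually.of_forall fun J => (hpart J).trans ?_)
  rw [← Finset.mul_sum, div_eq_mul_inv, ← tsum_geometric_of_lt_one hr hr1]
  exact mul_le_mul_of_nonneg_left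
    ((summable_geometric_of_lt_one hr hr1).sum_le_tsum _ fun _ _ => by positivity) hB

/-- The ratio of the geometric series of the dyadic blocks. -/
def dyadicRatio (s : ℝ) : ℝ := 2 ^ (1 / 2 - s)

lemma dyadicRatio_nonneg (s : ℝ) : 0 ≤ dyadicRatio s := by unfold dyadicRatio; positivity

lemma dyadicRatio_lt_one {s : ℝ} (hs : 1 / 2 < s) : dyadicRatio s < 1 :=
  Real.rpow_lt_one_of_one_lt_of_neg one_lt_two (by linarith)

lemma sum_block_le {s F : ℝ} (hs : 0 ≤ s) {a b : ℕ → ℝ}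
    (hF : ∀ M, energy s a M + energy s b M ≤ F ^ 2) {m n : ℕ} (hm : 1 ≤ m) :
    ∑ k ∈ Finset.Ioc m n, (a k ^ 2 + b k ^ 2) ≤ (((m : ℝ) ^ s)⁻¹ * F) ^ 2 := by
  have hm' : (0 : ℝ) < (m : ℝ) ^ s := Real.rpow_pos_of_pos (by exact_mod_cast hm) _
  have h1 : ((m : ℝ) ^ s) ^ 2 * ∑ k ∈ Finset.Ioc m n, (a k ^ 2 + b k ^ 2) ≤ F ^ 2 := by
    refine le_trans ?_ (hF n)
    rw [energy, energy, ← Finset.sum_add_distrib, Finset.mul_sum]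
    refine le_trans (Finset.sum_le_sum fun k hk => ?_)
      (Finset.sum_le_sum_of_subset_of_nonneg (s := Finset.Ioc m n) ?_ fun _ _ _ => by positivity)
    · rw [← mul_add]
      refine mul_le_mul_of_nonneg_right ?_ (by positivity)
      rw [← Real.rpow_natCast, ← Real.rpow_mul (by positivity), mul_comm s]
      push_cast
      have : (m : ℝ) ≤ k := by exact_mod_cast (Finset.mem_Ioc.1 hk).1.le
      gcongr
    · intro k hk
      rw [Finset.mem_Ioc] at hk
      rw [Finset.mem_Icc]
      omega
  rw [mul_pow, inv_pow, ← div_eq_inv_mul, le_div_iff₀ (by positivity), mul_comm]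
  exact h1

lemma sqrt_two_pow_mul_inv_rpow {L : ℕ} (s : ℝ) (j : ℕ) :
    √(2 ^ j) * (((2 ^ j * L : ℕ) : ℝ) ^ s)⁻¹ = ((L : ℝ) ^ s)⁻¹ * dyadicRatio s ^ j := by
  have h2 : ((2 : ℝ) ^ j) ^ s = (2 ^ s) ^ j := by
    rw [← Real.rpow_natCast, ← Real.rpow_natCast, ← Real.rpow_mul (by norm_num),
      ← Real.rpow_mul (by norm_num), mul_comm]
  push_cast
  rw [Real.mul_rpow (by positivity) (by positivity), h2, dyadicRatio,
    Real.rpow_sub (by norm_num), div_pow, Real.sqrt_eq_rpow, ← Real.rpow_natCast,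
    ← Real.rpow_mul (by norm_num), mul_comm (j : ℝ), Real.rpow_mul (by norm_num),
    Real.rpow_natCast, mul_inv]
  ring

/-- The values of `h` at the sampling points. -/
def sample {N : ℕ} (x : Fin N → ℝ) (h : ℝ → ℝ) : EuclideanSpace ℝ (Fin N) :=
  WithLp.toLp 2 fun i => h (x i)

lemma norm_sample_sq {N : ℕ} (x : Fin N → ℝ) (h : ℝ → ℝ) :
    ‖sample x h‖ ^ 2 = ∑ i, h (x i) ^ 2 := by
  rw [EuclideanSpace.norm_sq_eq]
  simp [sample]

/-- The block at `2 ^ j * L` loses `√(2 ^ j)` in the sampling inequality and gains `(2 ^ j * L) ^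
(-s)` from the energy, so the blocks form a geometric series of ratio `2 ^ (1/2 - s) < 1`. -/
lemma norm_sample_tail_le {N Q L : ℕ} {s F : ℝ} (hs : 1 / 2 < s) (hF0 : 0 ≤ F) (hL : 1 ≤ L)
    (hLQ : L ≤ Q) {x : Fin N → ℝ} (hx : WellSpread Q x) {a b : ℕ → ℝ} {h : ℝ → ℝ}
    (hF : ∀ M, energy s a M + energy s b M ≤ F ^ 2)
    (ha : ∀ n ≤ L, a n = 0) (hb : ∀ n ≤ L, b n = 0)
    (hh : ∀ i, HasSum (fun n : ℕ => a n * Real.cos (2 * Real.pi * n * x i) +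
      b n * Real.sin (2 * Real.pi * n * x i)) (h (x i))) :
    ‖sample x h‖ ≤ √N * (9 * ((L : ℝ) ^ s)⁻¹ * F / (1 - dyadicRatio s)) := by
  have hQ : 0 < Q := by omega
  have hQ' : (0 : ℝ) < Q := by exact_mod_cast hQ
  have hsum : HasSum (fun n : ℕ => sample x fun t => a n * Real.cos (2 * Real.pi * n * t) +
      b n * Real.sin (2 * Real.pi * n * t)) (sample x h) := by
    have h1 : HasSum (fun n : ℕ => fun i => a n * Real.cos (2 * Real.pi * n * x i) +
      b n * Real.sin (2 * Real.pi * n * x i)) (fun i => h (x i)) := Pi.hasSum.2 hh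
    exact h1.mapL (EuclideanSpace.equiv (Fin N) ℝ).symm.toContinuousLinearMap
  have := norm_le_of_dyadic_blocks hsum hL ?_ (B := √N * (9 * ((L : ℝ) ^ s)⁻¹ * F))
    (by positivity) (dyadicRatio_nonneg s) (dyadicRatio_lt_one hs) ?_
  · rwa [mul_div_assoc] at this
  · intro n hn
    ext i
    simp [sample, ha n hn, hb n hn]
  · intro j
    set S := Finset.Ioc (2 ^ j * L) (2 ^ (j + 1) * L) with hS
    have e : ∑ n ∈ S, sample x (fun t => a n * Real.cos (2 * Real.pi * n * t) +
        b n * Real.sin (2 * Real.pi * n * t)) = sample x (trigPoly S a b) := by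
      ext i
      simp [sample, trigPoly]
    rw [e]
    refine abs_le_of_sq_le_sq' ?_ (mul_nonneg (by positivity)
      (pow_nonneg (dyadicRatio_nonneg s) _)) |>.2
    rw [norm_sample_sq]
    have h1 := (sampled_trigPoly hQ hx S a b (2 ^ (j + 1) * L)
      fun n hn => (Finset.mem_Ioc.1 hn).2).1
    -- With `L ≤ Q` the factor is at most `3 + 24π · 2 ^ j`, and `81` is a square exceeding `3 +
    -- 24π`.
    have h2 : (3 + 12 * Real.pi * (2 ^ (j + 1) * L : ℕ) / Q : ℝ) ≤ 81 * 2 ^ j := by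
      have h3 : (L : ℝ) / Q ≤ 1 := (div_le_one hQ').2 (by exact_mod_cast hLQ)
      have h4 : (12 * Real.pi * (2 ^ (j + 1) * L : ℕ) / Q : ℝ) =
          24 * Real.pi * 2 ^ j * (L / Q) := by
        push_cast
        ring
      have h5 : (1 : ℝ) ≤ 2 ^ j := one_le_pow₀ one_le_two
      have h6 : 24 * Real.pi * 2 ^ j * (L / Q) ≤ 24 * Real.pi * 2 ^ j * 1 :=
        mul_le_mul_of_nonneg_left h3 (by positivity)
      have h7 := Real.pi_lt_d2
      rw [h4]
      nlinarith
    have h3 := sum_block_le (n := 2 ^ (j + 1) * L) (by linarith) hF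
      (m := 2 ^ j * L) (Nat.one_le_iff_ne_zero.2 (by positivity))
    calc _ ≤ _ := h1
      _ ≤ N * (81 * 2 ^ j) * ((((2 ^ j * L : ℕ) : ℝ) ^ s)⁻¹ * F) ^ 2 := by gcongr
      _ = (√N * (9 * (√(2 ^ j) * (((2 ^ j * L : ℕ) : ℝ) ^ s)⁻¹) * F)) ^ 2 := by
        simp only [mul_pow, Real.sq_sqrt (show (0 : ℝ) ≤ N by positivity),
          Real.sq_sqrt (show (0 : ℝ) ≤ 2 ^ j by positivity)]
        ring
      _ = (√N * (9 * ((L : ℝ) ^ s)⁻¹ * F) * dyadicRatio s ^ j) ^ 2 := by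
        rw [sqrt_two_pow_mul_inv_rpow]
        ring

/-- The same series as for samples, the factor `√(2 ^ j * L)` now coming from Cauchy–Schwarz over
the frequencies of a block. -/
lemma abs_tail_le {L : ℕ} {s F : ℝ} (hs : 1 / 2 < s) (hF0 : 0 ≤ F) (hL : 1 ≤ L)
    {a b : ℕ → ℝ} {x y : ℝ} (hF : ∀ M, energy s a M + energy s b M ≤ F ^ 2)
    (ha : ∀ n ≤ L, a n = 0) (hb : ∀ n ≤ L, b n = 0)
    (hh : HasSum (fun n : ℕ => a n * Real.cos (2 * Real.pi * n * x) +
      b n * Real.sin (2 * Real.pi * n * x)) y) :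
    |y| ≤ √L * ((L : ℝ) ^ s)⁻¹ * F / (1 - dyadicRatio s) := by
  refine norm_le_of_dyadic_blocks hh hL (fun n hn => by simp [ha n hn, hb n hn])
    (by positivity) (dyadicRatio_nonneg s) (dyadicRatio_lt_one hs) fun j => ?_
  refine abs_le_of_sq_le_sq' ?_ (mul_nonneg (by positivity)
    (pow_nonneg (dyadicRatio_nonneg s) _)) |>.2
  rw [Real.norm_eq_abs, sq_abs]
  have h3 := sum_block_le (n := 2 ^ (j + 1) * L) (by linarith) hF
    (m := 2 ^ j * L) (Nat.one_le_iff_ne_zero.2 (by positivity))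
  calc _ ≤ ((2 ^ (j + 1) * L - 2 ^ j * L : ℕ) : ℝ) *
        ∑ n ∈ Finset.Ioc (2 ^ j * L) (2 ^ (j + 1) * L), (a n ^ 2 + b n ^ 2) := by
        rw [← Nat.card_Ioc]
        refine sq_sum_le_card_mul_sum_sq.trans (mul_le_mul_of_nonneg_left
          (Finset.sum_le_sum fun n _ => ?_) (by positivity))
        have := Real.sin_sq_add_cos_sq (2 * Real.pi * n * x)
        nlinarith [sq_nonneg (a n * Real.sin (2 * Real.pi * n * x) -
          b n * Real.cos (2 * Real.pi * n * x))]
    _ ≤ (2 ^ j * L) * ((((2 ^ j * L : ℕ) : ℝ) ^ s)⁻¹ * F) ^ 2 := by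
        have : 2 ^ (j + 1) * L - 2 ^ j * L = 2 ^ j * L := by
          have : 2 ^ (j + 1) * L = 2 ^ j * L + 2 ^ j * L := by ring
          omega
        rw [this]
        push_cast at h3 ⊢
        gcongr
    _ = (√L * ((√(2 ^ j) * (((2 ^ j * L : ℕ) : ℝ) ^ s)⁻¹) * F)) ^ 2 := by
        simp only [mul_pow, Real.sq_sqrt (show (0 : ℝ) ≤ L by positivity),
          Real.sq_sqrt (show (0 : ℝ) ≤ 2 ^ j by positivity)]
        ring
    _ = _ := by
        rw [sqrt_two_pow_mul_inv_rpow]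
        ring

/-- Bessel's bound for the partial sums passes to the pointwise limit by Fatou's lemma. -/
lemma eLpNorm_two_le_of_hasSum {a b : ℕ → ℝ} {h : ℝ → ℝ} {B : ℝ} (hB0 : 0 ≤ B)
    (hB : ∀ M, ∑ n ∈ Finset.range M, (a n ^ 2 + b n ^ 2) ≤ B ^ 2)
    (hh : ∀ x ∈ Set.Icc (0 : ℝ) 1, HasSum (fun n : ℕ => a n * Real.cos (2 * Real.pi * n * x) +
      b n * Real.sin (2 * Real.pi * n * x)) (h x)) :
    eLpNorm h 2 (volume.restrict (Set.Icc (0 : ℝ) 1)) ≤ ENNReal.ofReal B := by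
  have hM : ∀ M, eLpNorm (trigPoly (Finset.range M) a b) 2
      (volume.restrict (Set.Icc (0 : ℝ) 1)) ≤ ENNReal.ofReal B := by
    intro M
    have hc := continuous_trigPoly (Finset.range M) a b
    have hmem : MemLp (trigPoly (Finset.range M) a b) 2 (volume.restrict (Set.Icc (0 : ℝ) 1)) :=
      
      (memLp_two_iff_integrable_sq hc.aestronglyMeasurable).2 (hc.pow 2).integrableOn_Icc
    rw [hmem.eLpNorm_eq_integral_rpow_norm (by norm_num) (by norm_num)]
    refine ENNReal.ofReal_le_ofReal ?_
    have e : ∫ x in Set.Icc (0 : ℝ) 1, ‖trigPoly (Finset.range M) a b x‖ ^ (2 : ℝ≥0∞).toReal =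
        ∫ x in (0 : ℝ)..1, trigPoly (Finset.range M) a b x ^ 2 := by
      rw [intervalIntegral.integral_of_le zero_le_one, integral_Icc_eq_integral_Ioc]
      simp
    rw [e]
    simp only [ENNReal.toReal_ofNat]
    rw [← one_div, ← Real.sqrt_eq_rpow]
    exact Real.sqrt_le_iff.2 ⟨hB0, (integral_trigPoly_sq_le _ _ _).trans (hB M)⟩
  refine (Lp.eLpNorm_lim_le_liminf_eLpNorm
    (fun M => (continuous_trigPoly (Finset.range M) a b).aestronglyMeasurable) h ?_).trans ?_
  · exact (ae_restrict_iff' measurableSet_Icc).2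
      (Filter.Eventually.of_forall fun x hx => (hh x hx).tendsto_sum_nat)
  · exact Filter.liminf_le_of_frequently_le' (Filter.Frequently.of_forall hM)

/-! ### Random points are well spread -/

instance : IsProbabilityMeasure (volume.restrict (Set.Icc (0 : ℝ) 1)) :=
  ⟨by simp⟩

instance (N : ℕ) : IsProbabilityMeasure (uniformPoints N) := by
  unfold uniformPoints
  infer_instance

lemma real_cell {Q : ℕ} (hQ : 0 < Q) {j : ℕ} (hj : j < Q) :
    (volume.restrict (Set.Icc (0 : ℝ) 1)).real (Set.Ico ((j : ℝ) / Q) ((j + 1 : ℝ) / Q)) =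
      (Q : ℝ)⁻¹ := by
  have hQ' : (0 : ℝ) < Q := by exact_mod_cast hQ
  have hj' : (j + 1 : ℝ) ≤ Q := by exact_mod_cast hj
  have hsub : Set.Ico ((j : ℝ) / Q) ((j + 1 : ℝ) / Q) ⊆ Set.Icc 0 1 := by
    intro t ht
    refine ⟨le_trans (by positivity) ht.1, ht.2.le.trans ((div_le_one hQ').2 hj')⟩
  rw [measureReal_restrict_apply measurableSet_Ico, Set.inter_eq_left.2 hsub,
    Real.volume_real_Ico_of_le (by gcongr; linarith)]
  field_simp
  ring

/-- The number of points in a set. -/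
def countIn {N : ℕ} (I : Set ℝ) (x : Fin N → ℝ) : ℝ := ∑ i, I.indicator 1 (x i)

lemma measurable_countIn {N : ℕ} {I : Set ℝ} (hI : MeasurableSet I) :
    Measurable (countIn (N := N) I) := by
  unfold countIn
  refine Finset.measurable_sum _ fun i _ => ?_
  exact (measurable_one.indicator hI).comp (measurable_pi_apply i)

/-- Chernoff's bound for the number of points in a set. -/
lemma chernoff {N : ℕ} {I : Set ℝ} (hI : MeasurableSet I) (c θ : ℝ) :
    (uniformPoints N).real {x | θ ≤ c * countIn I x} ≤
      Real.exp (N * (volume.restrict (Set.Icc (0 : ℝ) 1)).real I * (Real.exp c - 1) - θ) := by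
  set μ := volume.restrict (Set.Icc (0 : ℝ) 1)
  set f : ℝ → ℝ := fun t => Real.exp (c * I.indicator 1 t) with hf
  have hfe : f = fun t => 1 + I.indicator (fun _ => Real.exp c - 1) t := by
    ext t
    by_cases ht : t ∈ I <;> simp [hf, ht]
  have hint : Integrable f μ := by
    rw [hfe]
    exact (integrable_const _).add ((integrable_const _).indicator hI)
  have hval : ∫ t, f t ∂μ = 1 + μ.real I * (Real.exp c - 1) := by
    rw [hfe, integral_add (integrable_const _) ((integrable_const _).indicator hI),
      integral_indicator_const _ hI]
    simp
  have hprod : ∀ x : Fin N → ℝ, Real.exp (c * countIn I x) = ∏ i, f (x i) := by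
    intro x
    rw [countIn, Finset.mul_sum, Real.exp_sum]
  have hE : ∫ x, Real.exp (c * countIn I x) ∂(uniformPoints N) ≤
      Real.exp (N * μ.real I * (Real.exp c - 1)) := by
    simp_rw [hprod]
    rw [uniformPoints, integral_fintype_prod_eq_pow, hval, Fintype.card_fin, mul_assoc,
      Real.exp_nat_mul]
    refine pow_le_pow_left₀ ?_ ?_ _
    · rw [← hval]
      exact integral_nonneg fun t => (Real.exp_pos _).le
    · rw [add_comm]
      exact Real.add_one_le_exp _
  have hI' : Integrable (fun x => Real.exp (c * countIn I x)) (uniformPoints N) := by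
    simp_rw [hprod]
    exact Integrable.fintype_prod (f := fun _ => f) fun _ => hint
  have hm := mul_meas_ge_le_integral_of_nonneg (μ := uniformPoints N)
    (f := fun x => Real.exp (c * countIn I x))
    (Filter.Eventually.of_forall fun x => (Real.exp_pos _).le) hI' (Real.exp θ)
  simp only [Real.exp_le_exp] at hm
  rw [Real.exp_sub, le_div_iff₀ (Real.exp_pos _), mul_comm]
  exact hm.trans hE

lemma setOf_wellSpread {N : ℕ} (Q : ℕ) :
    {x : Fin N → ℝ | WellSpread Q x} = (⋂ i, {x | x i ∈ Set.Ico (0 : ℝ) 1}) ∩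
      ⋂ j ∈ Finset.range Q,
        ({x | (N : ℝ) / (4 * Q) ≤ countIn (Set.Ico ((j : ℝ) / Q) ((j + 1 : ℝ) / Q)) x} ∩
        {x | countIn (Set.Ico ((j : ℝ) / Q) ((j + 1 : ℝ) / Q)) x ≤ 3 * (N : ℝ) / Q}) := by
  ext x
  simp [WellSpread, countIn]

lemma measurableSet_wellSpread {N : ℕ} (Q : ℕ) :
    MeasurableSet {x : Fin N → ℝ | WellSpread Q x} := by
  rw [setOf_wellSpread]
  refine (MeasurableSet.iInter fun i => measurable_pi_apply i measurableSet_Ico).inter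
    (Finset.measurableSet_biInter _ fun j _ => ?_)
  exact (measurableSet_le measurable_const (measurable_countIn measurableSet_Ico)).inter
    (measurableSet_le (measurable_countIn measurableSet_Ico) measurable_const)

/-- Each of the `2 Q` one-sided deviations has probability at most `N⁻³`, and there are at most `N`
cells. -/
lemma real_wellSpread_ge {N Q : ℕ} (hQ : 0 < Q) (hN : 2 ≤ N)
    (h : 24 * (Q : ℝ) * Real.log N ≤ N) :
    1 - 2 / (N : ℝ) ^ 2 ≤ (uniformPoints N).real {x | WellSpread Q x} := by
  have hQ' : (0 : ℝ) < Q := by exact_mod_cast hQ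
  have hN' : (2 : ℝ) ≤ N := by exact_mod_cast hN
  have hN0 : (0 : ℝ) < N := by linarith
  have hlog : 1 / 2 ≤ Real.log N := by
    have h1 := Real.log_le_log (by norm_num) hN'
    have h2 := Real.log_two_gt_d9
    linarith
  have hQN : (Q : ℝ) ≤ N := by nlinarith
  set P := uniformPoints N with hP
  set I : ℕ → Set ℝ := fun j => Set.Ico ((j : ℝ) / Q) ((j + 1 : ℝ) / Q) with hI
  -- The constant `24 = 8 · 3` makes `N / (8 Q) ≥ 3 log N`.
  have hexp : Real.exp (-(N / (8 * Q) : ℝ)) ≤ ((N : ℝ) ^ 3)⁻¹ := by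
    have : ((N : ℝ) ^ 3)⁻¹ = Real.exp (-(3 * Real.log N)) := by
      rw [Real.exp_neg, mul_comm, Real.exp_mul, Real.exp_log hN0]
      norm_cast
    rw [this, Real.exp_le_exp, neg_le_neg_iff, le_div_iff₀ (by positivity)]
    linarith
  -- Chernoff with `c = 1`: the exponent is `(N/Q)(e - 4)`.
  have hup : ∀ j < Q, P.real {x | 3 * (N : ℝ) / Q < countIn (I j) x} ≤ ((N : ℝ) ^ 3)⁻¹ := by
    intro j hj
    refine (measureReal_mono ?_).trans ((chernoff (N := N) (I := I j) measurableSet_Ico 1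
      (3 * (N : ℝ) / Q)).trans (le_trans (Real.exp_le_exp.2 ?_) hexp))
    · intro x hx
      simp only [Set.mem_ofPred_eq, one_mul] at hx ⊢
      exact hx.le
    · rw [real_cell hQ hj]
      have := Real.exp_one_lt_d9
      have e : N * (Q : ℝ)⁻¹ * (Real.exp 1 - 1) - 3 * (N : ℝ) / Q =
        N / Q * (Real.exp 1 - 4) := by field_simp; ring
      have e' : -(N / (8 * Q) : ℝ) = N / Q * (-1 / 8) := by field_simp
      rw [e, e']
      exact mul_le_mul_of_nonneg_left (by linarith) (by positivity)
  -- Chernoff with `c = -1`: the exponent is `(N/Q)(e⁻¹ - 3/4)`, at most `-N/(4Q)`.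
  have hlow : ∀ j < Q, P.real {x | countIn (I j) x < (N : ℝ) / (4 * Q)} ≤ ((N : ℝ) ^ 3)⁻¹ := by
    intro j hj
    refine (measureReal_mono ?_).trans ((chernoff (N := N) (I := I j) measurableSet_Ico (-1)
      (-((N : ℝ) / (4 * Q)))).trans (le_trans (Real.exp_le_exp.2 ?_) hexp))
    · intro x hx
      simp only [Set.mem_ofPred_eq, neg_mul, one_mul, neg_le_neg_iff] at hx ⊢
      exact hx.le
    · rw [real_cell hQ hj]
      have h1 : Real.exp (-1) ≤ 1 / 2 := by
        rw [Real.exp_neg, one_div]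
        have := Real.add_one_le_exp 1
        gcongr
        linarith
      have e : N * (Q : ℝ)⁻¹ * (Real.exp (-1) - 1) - -((N : ℝ) / (4 * Q)) =
        N / Q * (Real.exp (-1) - 3 / 4) := by field_simp; ring
      have e' : -(N / (8 * Q) : ℝ) = N / Q * (-1 / 8) := by field_simp
      rw [e, e']
      exact mul_le_mul_of_nonneg_left (by linarith) (by positivity)
  have hnull : P.real (⋃ i, {x | x i ∉ Set.Ico (0 : ℝ) 1}) = 0 := by
    rw [measureReal_eq_zero_iff, measure_iUnion_null_iff]
    intro i
    have h1 : ∀ᵐ t ∂(volume.restrict (Set.Icc (0 : ℝ) 1)), t ∈ Set.Ico (0 : ℝ) 1 := by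
      rw [← Measure.restrict_congr_set Ico_ae_eq_Icc]
      exact ae_restrict_mem measurableSet_Ico
    have h2 := (Measure.quasiMeasurePreserving_eval
      (fun _ : Fin N => volume.restrict (Set.Icc (0 : ℝ) 1)) i).ae h1
    exact h2
  have hcompl : {x : Fin N → ℝ | WellSpread Q x}ᶜ ⊆ (⋃ i, {x | x i ∉ Set.Ico (0 : ℝ) 1}) ∪
      ⋃ j ∈ Finset.range Q, ({x | 3 * (N : ℝ) / Q < countIn (I j) x} ∪
        {x | countIn (I j) x < (N : ℝ) / (4 * Q)}) := by
    intro x hx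
    by_contra hc
    refine hx ⟨fun i => ?_, fun j hj => ⟨?_, ?_⟩⟩ <;> by_contra hcon <;> refine hc ?_
    · exact Or.inl (Set.mem_iUnion.2 ⟨i, hcon⟩)
    · exact Or.inr (Set.mem_biUnion (Finset.mem_range.2 hj) (Or.inr (not_le.1 hcon)))
    · exact Or.inr (Set.mem_biUnion (Finset.mem_range.2 hj) (Or.inl (not_le.1 hcon)))
  have hbad : P.real {x | WellSpread Q x}ᶜ ≤ 2 / (N : ℝ) ^ 2 := by
    calc _ ≤ _ := measureReal_mono hcompl
      _ ≤ _ := measureReal_union_le _ _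
      _ ≤ 0 + ∑ j ∈ Finset.range Q, (((N : ℝ) ^ 3)⁻¹ + ((N : ℝ) ^ 3)⁻¹) := by
          rw [hnull]
          gcongr
          refine (measureReal_biUnion_finset_le _ _).trans (Finset.sum_le_sum fun j hj => ?_)
          exact (measureReal_union_le _ _).trans (add_le_add (hup j (Finset.mem_range.1 hj))
            (hlow j (Finset.mem_range.1 hj)))
      _ = Q * (2 / (N : ℝ) ^ 3) := by simp; ring
      _ ≤ N * (2 / (N : ℝ) ^ 3) := by gcongr
      _ = 2 / (N : ℝ) ^ 2 := by field_simp
  rw [probReal_compl_eq_one_sub (measurableSet_wellSpread Q)] at hbad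
  linarith

/-! ### Coefficients and Fourier series of elements of `hatSpace` -/

lemma abs_hatCos_le (x : ℝ) : |hatCos x| ≤ 1 := by
  have h0 := Int.fract_nonneg x
  have h1 := (Int.fract_lt_one x).le
  have h2 : |Int.fract x - 1 / 2| ≤ 1 / 2 := abs_le.2 ⟨by linarith, by linarith⟩
  rw [hatCos, abs_le]
  constructor <;> linarith [abs_nonneg (Int.fract x - 1 / 2)]

lemma abs_hatSin_le (x : ℝ) : |hatSin x| ≤ 1 := by
  rw [hatSin_eq]
  exact abs_hatCos_le _

/-- The element of `hatSpace R` with coefficients `c`, `γ`, `δ` with respect to the generators,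
those of positive frequency being normalized to have leading Fourier coefficient one. -/
def hatPoly (R : ℕ) (c : ℝ) (γ δ : ℕ → ℝ) (x : ℝ) : ℝ :=
  c + ∑ k ∈ Finset.Icc 1 R, (γ k * (Real.pi ^ 2 / 8 * hatCos (k * x)) +
    δ k * (Real.pi ^ 2 / 8 * hatSin (k * x)))

lemma hatPoly_mem (R : ℕ) (c : ℝ) (γ δ : ℕ → ℝ) : hatPoly R c γ δ ∈ hatSpace R := by
  have e : hatPoly R c γ δ = c • (fun _ => (1 : ℝ)) + ∑ k ∈ Finset.Icc 1 R,
      ((γ k * (Real.pi ^ 2 / 8)) • (fun x : ℝ => hatCos (k * x)) +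
        (δ k * (Real.pi ^ 2 / 8)) • (fun x : ℝ => hatSin (k * x))) := by
    ext x
    simp [hatPoly, mul_assoc]
  rw [e]
  refine Submodule.add_mem _ (Submodule.smul_mem _ _ (Submodule.subset_span (Or.inl rfl)))
    (Submodule.sum_mem _ fun k hk => ?_)
  obtain ⟨h1, h2⟩ := Finset.mem_Icc.1 hk
  exact Submodule.add_mem _
    (Submodule.smul_mem _ _ (Submodule.subset_span (Or.inr ⟨k, h1, h2, Or.inl rfl⟩)))
    (Submodule.smul_mem _ _ (Submodule.subset_span (Or.inr ⟨k, h1, h2, Or.inr rfl⟩)))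

/-- The restriction of an arithmetic function to arguments `≤ R`. -/
def truncate (R : ℕ) (a : ArithmeticFunction ℝ) : ArithmeticFunction ℝ where
  toFun n := if n ≤ R then a n else 0
  map_zero' := by simp

lemma truncate_apply (R : ℕ) (a : ArithmeticFunction ℝ) (n : ℕ) :
    truncate R a n = if n ≤ R then a n else 0 := rfl

lemma exists_hatPoly {R : ℕ} {u : ℝ → ℝ} (hu : u ∈ hatSpace R) :
    ∃ (c : ℝ) (γ δ : ArithmeticFunction ℝ), (∀ n, R < n → γ n = 0) ∧ (∀ n, R < n → δ n = 0) ∧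
      u = hatPoly R c γ δ := by
  have hpi : Real.pi ^ 2 ≠ 0 := by positivity
  -- The value `8 / π²` undoes the normalization in `hatPoly`; arithmetic functions must vanish at
  -- `0`, whence `n ≠ 0`.
  let e (k : ℕ) : ArithmeticFunction ℝ := ⟨fun n => if n = k ∧ n ≠ 0 then 8 / Real.pi ^ 2 else 0,
    by simp⟩
  have he : ∀ k n, e k n = if n = k ∧ n ≠ 0 then 8 / Real.pi ^ 2 else 0 := fun _ _ => rfl
  induction hu using Submodule.span_induction with
  | mem u h =>
    rcases h with h | ⟨k, h1, h2, h | h⟩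
    · refine ⟨1, 0, 0, fun _ _ => rfl, fun _ _ => rfl, ?_⟩
      rw [Set.mem_singleton_iff.1 h]
      ext x
      simp [hatPoly]
    · refine ⟨0, e k, 0, fun n hn => ?_, fun _ _ => rfl, ?_⟩
      · rw [he, if_neg (by omega)]
      · rw [h]
        ext x
        rw [hatPoly, Finset.sum_eq_single_of_mem k (Finset.mem_Icc.2 ⟨h1, h2⟩)]
        · rw [he, if_pos ⟨rfl, by omega⟩]
          simp only [ArithmeticFunction.zero_apply]
          field_simp
          ring
        · intro n _ hn
          rw [he, if_neg (by tauto)]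
          simp
    · refine ⟨0, 0, e k, fun _ _ => rfl, fun n hn => ?_, ?_⟩
      · rw [he, if_neg (by omega)]
      · rw [h]
        ext x
        rw [hatPoly, Finset.sum_eq_single_of_mem k (Finset.mem_Icc.2 ⟨h1, h2⟩)]
        · rw [he, if_pos ⟨rfl, by omega⟩]
          simp only [ArithmeticFunction.zero_apply]
          field_simp
          ring
        · intro n _ hn
          rw [he, if_neg (by tauto)]
          simp
  | zero =>
    refine ⟨0, 0, 0, fun _ _ => rfl, fun _ _ => rfl, ?_⟩
    ext x
    simp [hatPoly]
  | add u v _ _ hu hv =>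
    obtain ⟨c, γ, δ, h1, h2, rfl⟩ := hu
    obtain ⟨c', γ', δ', h1', h2', rfl⟩ := hv
    refine ⟨c + c', γ + γ', δ + δ', fun n hn => ?_, fun n hn => ?_, ?_⟩
    · simp [h1 n hn, h1' n hn]
    · simp [h2 n hn, h2' n hn]
    · ext x
      simp only [hatPoly, Pi.add_apply, ArithmeticFunction.add_apply]
      rw [add_add_add_comm, ← Finset.sum_add_distrib]
      congr 1
      exact Finset.sum_congr rfl fun k _ => by ring
  | smul t u _ hu =>
    obtain ⟨c, γ, δ, h1, h2, rfl⟩ := hu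
    refine ⟨t * c, ⟨fun n => t * γ n, by simp⟩, ⟨fun n => t * δ n, by simp⟩, fun n hn => ?_,
      fun n hn => ?_, ?_⟩
    · change t * γ n = 0
      simp [h1 n hn]
    · change t * δ n = 0
      simp [h2 n hn]
    · ext x
      simp only [hatPoly, Pi.smul_apply, smul_eq_mul, ArithmeticFunction.coe_mk]
      rw [mul_add, Finset.mul_sum]
      congr 1
      exact Finset.sum_congr rfl fun k _ => by ring

lemma convolution_eq_sum_of_support {R : ℕ} (w γ : ArithmeticFunction ℝ)
    (hγ : ∀ n, R < n → γ n = 0) (n : ℕ) :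
    (w * γ) n = ∑ k ∈ Finset.Icc 1 R, if k ∣ n then γ k * w (n / k) else 0 := by
  rcases Nat.eq_zero_or_pos n with rfl | hn
  · simp
  rw [ArithmeticFunction.mul_apply, Nat.sum_divisorsAntidiagonal' (f := fun i j => w i * γ j),
    ← Finset.sum_filter]
  symm
  refine (Finset.sum_subset ?_ ?_).trans (Finset.sum_congr rfl fun _ _ => mul_comm _ _)
  · intro k hk
    rw [Finset.mem_filter] at hk
    exact Nat.mem_divisors.2 ⟨hk.2, hn.ne'⟩
  · intro k hk hk'
    have hd := Nat.dvd_of_mem_divisors hk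
    have hpos := Nat.pos_of_dvd_of_pos hd hn
    rw [hγ k, zero_mul]
    by_contra hR
    exact hk' (Finset.mem_filter.2 ⟨Finset.mem_Icc.2 ⟨hpos, by omega⟩, hd⟩)

/-- Collecting the frequencies `n = j k` of the dilated series turns the sum over `k` into a
Dirichlet convolution. -/
lemma hasSum_convolution {R : ℕ} (w γ : ArithmeticFunction ℝ) (hγ : ∀ n, R < n → γ n = 0)
    (T H : ℕ → ℝ) (hT : ∀ k, 1 ≤ k → HasSum (fun j => w j * T (j * k)) (H k)) :
    HasSum (fun n => (w * γ) n * T n) (∑ k ∈ Finset.Icc 1 R, γ k * H k) := by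
  have h1 : ∀ k ∈ Finset.Icc 1 R,
      HasSum (fun n => (if k ∣ n then γ k * w (n / k) else 0) * T n) (γ k * H k) := by
    intro k hk
    have hk1 : 0 < k := (Finset.mem_Icc.1 hk).1
    have hinj : Function.Injective fun j : ℕ => j * k := fun i j h =>
      Nat.eq_of_mul_eq_mul_right hk1 h
    rw [← hinj.hasSum_iff]
    · refine ((hT k hk1).mul_left (γ k)).congr_fun fun j => ?_
      simp only [Function.comp_apply, if_pos (Dvd.intro_left j rfl), Nat.mul_div_cancel _ hk1]
      ring
    · intro n hn
      rw [if_neg, zero_mul]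
      rintro ⟨j, rfl⟩
      exact hn ⟨j, mul_comm _ _⟩
  refine (hasSum_sum h1).congr_fun fun n => ?_
  rw [convolution_eq_sum_of_support w γ hγ, Finset.sum_mul]

lemma hasSum_hatPoly {R : ℕ} (c : ℝ) (γ δ : ArithmeticFunction ℝ) (hγ : ∀ n, R < n → γ n = 0)
    (hδ : ∀ n, R < n → δ n = 0) (x : ℝ) :
    HasSum (fun n : ℕ => (twist oddInd * γ) n * Real.cos (2 * Real.pi * n * x) +
      (twist oddSign * δ) n * Real.sin (2 * Real.pi * n * x)) (hatPoly R c γ δ x - c) := by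
  have h1 := hasSum_convolution (twist oddInd) γ hγ (fun n => Real.cos (2 * Real.pi * n * x))
    (fun k => Real.pi ^ 2 / 8 * hatCos (k * x)) fun k _ =>
      (hasSum_hatCos (k * x)).congr_fun fun j => by
        push_cast
        rw [show 2 * Real.pi * ((j : ℝ) * k) * x = 2 * Real.pi * j * (k * x) by ring]
  have h2 := hasSum_convolution (twist oddSign) δ hδ (fun n => Real.sin (2 * Real.pi * n * x))
    (fun k => Real.pi ^ 2 / 8 * hatSin (k * x)) fun k _ =>
      (hasSum_hatSin (k * x)).congr_fun fun j => by
        push_cast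
        rw [show 2 * Real.pi * ((j : ℝ) * k) * x = 2 * Real.pi * j * (k * x) by ring]
  have h := h1.add h2
  rwa [← Finset.sum_add_distrib, show ∑ k ∈ Finset.Icc 1 R,
    (γ k * (Real.pi ^ 2 / 8 * hatCos (k * x)) + δ k * (Real.pi ^ 2 / 8 * hatSin (k * x))) =
    hatPoly R c γ δ x - c by rw [hatPoly]; ring] at h

lemma energy_nonneg (s : ℝ) (a : ℕ → ℝ) (M : ℕ) : 0 ≤ energy s a M :=
  Finset.sum_nonneg fun _ _ => by positivity

lemma energy_zero (a : ℕ → ℝ) (M : ℕ) : energy 0 a M = ∑ n ∈ Finset.Icc 1 M, a n ^ 2 := by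
  simp [energy]

lemma energy_mono (s : ℝ) (a : ℕ → ℝ) {M M' : ℕ} (h : M ≤ M') :
    energy s a M ≤ energy s a M' :=
  Finset.sum_le_sum_of_subset_of_nonneg (Finset.Icc_subset_Icc_right h)
    fun _ _ _ => by positivity

lemma energy_le_of_support {s : ℝ} (hs : 0 ≤ s) {a : ℕ → ℝ} {R : ℕ} (ha : ∀ n, R < n → a n = 0)
    (M : ℕ) : energy s a M ≤ ((R : ℝ) ^ s) ^ 2 * energy 0 a R := by
  have h1 : energy s a M ≤ energy s a R := by
    rw [energy, ← Finset.sum_filter_add_sum_filter_not _ (fun n => n ≤ R),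
      Finset.sum_eq_zero (s := Finset.filter (fun n => ¬ n ≤ R) _), add_zero]
    · refine Finset.sum_le_sum_of_subset_of_nonneg ?_ fun _ _ _ => by positivity
      intro n hn
      rw [Finset.mem_filter, Finset.mem_Icc] at hn
      exact Finset.mem_Icc.2 ⟨hn.1.1, hn.2⟩
    · intro n hn
      rw [ha n (not_le.1 (Finset.mem_filter.1 hn).2)]
      simp
  refine h1.trans ?_
  rw [energy_zero, energy, Finset.mul_sum]
  refine Finset.sum_le_sum fun n hn => mul_le_mul_of_nonneg_right ?_ (sq_nonneg _)
  rw [← Real.rpow_natCast, ← Real.rpow_mul (by positivity), mul_comm s]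
  push_cast
  have : (n : ℝ) ≤ R := by exact_mod_cast (Finset.mem_Icc.1 hn).2
  gcongr

/-- The Euclidean length of the coefficient vector of `hatPoly R c γ δ`. -/
def coeffNorm (R : ℕ) (c : ℝ) (γ δ : ℕ → ℝ) : ℝ :=
  √(c ^ 2 + (energy 0 γ R + energy 0 δ R))

lemma coeffNorm_nonneg (R : ℕ) (c : ℝ) (γ δ : ℕ → ℝ) : 0 ≤ coeffNorm R c γ δ :=
  Real.sqrt_nonneg _

lemma coeffNorm_sq (R : ℕ) (c : ℝ) (γ δ : ℕ → ℝ) :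
    coeffNorm R c γ δ ^ 2 = c ^ 2 + (energy 0 γ R + energy 0 δ R) :=
  Real.sq_sqrt (add_nonneg (sq_nonneg _) (add_nonneg (energy_nonneg _ _ _) (energy_nonneg _ _ _)))

/-- A Bernstein-type inequality on `hatSpace R`: hat coefficients supported up to `R` have weighted
energy at most `R ^ (2 s)` times the unweighted one, and convolution preserves this for `s < 1`. -/
lemma energy_twist_le {s : ℝ} (hs : 0 ≤ s) (hs1 : s < 1) {R : ℕ} {γ δ : ArithmeticFunction ℝ}
    (c : ℝ) (hγ : ∀ n, R < n → γ n = 0) (hδ : ∀ n, R < n → δ n = 0) (M : ℕ) :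
    energy s (twist oddInd * γ : ArithmeticFunction ℝ) M +
      energy s (twist oddSign * δ : ArithmeticFunction ℝ) M ≤
      (dilationConst s * (R : ℝ) ^ s * coeffNorm R c γ δ) ^ 2 := by
  have h1 := energy_convolution_le hs1 (twist oddInd) γ (abs_twist_le _ abs_oddInd_le) M
  have h2 := energy_convolution_le hs1 (twist oddSign) δ (abs_twist_le _ abs_oddSign_le) M
  have h3 := mul_le_mul_of_nonneg_left (energy_le_of_support hs hγ M) (sq_nonneg (dilationConst s))
  have h4 := mul_le_mul_of_nonneg_left (energy_le_of_support hs hδ M) (sq_nonneg (dilationConst s))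
  rw [mul_pow, mul_pow, coeffNorm_sq]
  nlinarith [show 0 ≤ dilationConst s ^ 2 * ((R : ℝ) ^ s) ^ 2 * c ^ 2 by positivity]

/-- A convolution at `n` involves only divisors of `n`, so the Fourier coefficients up to `R` alone
recover `γ` and `δ` up to `R` through the Dirichlet inverse. -/
lemma coeffNorm_sq_le {R : ℕ} (c : ℝ) (γ δ : ArithmeticFunction ℝ) :
    coeffNorm R c γ δ ^ 2 ≤ dilationConst 0 ^ 2 * (c ^ 2 +
      (energy 0 (twist oddInd * γ : ArithmeticFunction ℝ) R +
        energy 0 (twist oddSign * δ : ArithmeticFunction ℝ) R)) := by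
  have e : ∀ (χ : ℕ →*₀ ℤ) (a : ArithmeticFunction ℝ), twistInv χ * (twist χ * a) = a := by
    intro χ a
    rw [← mul_assoc, mul_comm (twistInv χ), twist_mul_twistInv, one_mul]
  have h1 := energy_convolution_le zero_lt_one (twistInv oddInd) (twist oddInd * γ)
    (abs_twistInv_le _ abs_oddInd_le) R
  have h2 := energy_convolution_le zero_lt_one (twistInv oddSign) (twist oddSign * δ)
    (abs_twistInv_le _ abs_oddSign_le) R
  rw [e] at h1 h2
  have h3 : 1 ≤ dilationConst 0 ^ 2 := one_le_pow₀ (one_le_dilationConst zero_lt_one)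
  rw [coeffNorm_sq]
  nlinarith [sq_nonneg c]

/-- Cauchy–Schwarz over the `R` dilates; `5 = 1 + 2 + 2`, for the constant and the two families with
`π² / 8 ≤ 2`. -/
lemma abs_hatPoly_le {R : ℕ} (hR : 1 ≤ R) (c : ℝ) (γ δ : ℕ → ℝ) (x : ℝ) :
    |hatPoly R c γ δ x| ≤ 5 * √R * coeffNorm R c γ δ := by
  have hR' : (1 : ℝ) ≤ √R := Real.one_le_sqrt.2 (by exact_mod_cast hR)
  have hG := coeffNorm_nonneg R c γ δ
  have hGs := coeffNorm_sq R c γ δ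
  have hsum : ∀ a : ℕ → ℝ, energy 0 a R ≤ coeffNorm R c γ δ ^ 2 →
      ∑ k ∈ Finset.Icc 1 R, |a k| ≤ √R * coeffNorm R c γ δ := by
    intro a ha
    refine (abs_le_of_sq_le_sq' ?_ (by positivity)).2
    refine sq_sum_le_card_mul_sum_sq.trans ?_
    rw [mul_pow, Real.sq_sqrt (by positivity), Nat.card_Icc, Nat.add_sub_cancel]
    rw [energy_zero] at ha
    simp only [sq_abs]
    gcongr
  have h1 := hsum γ (by rw [hGs]; nlinarith [sq_nonneg c, energy_nonneg 0 δ R])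
  have h2 := hsum δ (by rw [hGs]; nlinarith [sq_nonneg c, energy_nonneg 0 γ R])
  have hc : |c| ≤ coeffNorm R c γ δ := by
    refine (abs_le_of_sq_le_sq' ?_ hG).2
    rw [sq_abs, hGs]
    linarith [energy_nonneg 0 γ R, energy_nonneg 0 δ R]
  have hpi : Real.pi ^ 2 / 8 ≤ 2 := by
    have := Real.pi_lt_d2
    nlinarith [Real.pi_pos]
  have hpi0 : 0 ≤ Real.pi ^ 2 / 8 := by positivity
  have hterm : ∀ a t : ℝ, |t| ≤ 1 → |a * (Real.pi ^ 2 / 8 * t)| ≤ 2 * |a| := by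
    intro a t ht
    rw [abs_mul, abs_mul, abs_of_nonneg hpi0, mul_comm 2]
    refine mul_le_mul_of_nonneg_left ?_ (abs_nonneg _)
    nlinarith [abs_nonneg t]
  have h3 : |∑ k ∈ Finset.Icc 1 R, (γ k * (Real.pi ^ 2 / 8 * hatCos (k * x)) +
      δ k * (Real.pi ^ 2 / 8 * hatSin (k * x)))| ≤
      2 * ∑ k ∈ Finset.Icc 1 R, |γ k| + 2 * ∑ k ∈ Finset.Icc 1 R, |δ k| := by
    rw [Finset.mul_sum, Finset.mul_sum, ← Finset.sum_add_distrib]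
    refine (Finset.abs_sum_le_sum_abs _ _).trans (Finset.sum_le_sum fun k _ => ?_)
    exact (abs_add_le _ _).trans (add_le_add (hterm _ _ (abs_hatCos_le _))
      (hterm _ _ (abs_hatSin_le _)))
  rw [hatPoly]
  refine (abs_add_le _ _).trans ?_
  nlinarith

/-- The coefficient sequence of the sum of a constant and a trigonometric series. -/
def withConst (c : ℝ) (a : ℕ → ℝ) (n : ℕ) : ℝ := if n = 0 then c else a n

lemma sum_range_withConst (c : ℝ) (a : ℕ → ℝ) {b : ℕ → ℝ} (hb : b 0 = 0) (L : ℕ) :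
    ∑ n ∈ Finset.range (L + 1), (withConst c a n ^ 2 + b n ^ 2) =
      c ^ 2 + (energy 0 a L + energy 0 b L) := by
  rw [energy_zero, energy_zero, ← Finset.sum_add_distrib, Finset.range_eq_Ico,
    Finset.sum_eq_sum_Ico_succ_bot (Nat.succ_pos L)]
  congr 1
  · simp [withConst, hb]
  · refine Finset.sum_congr ?_ fun n hn => ?_
    · ext n
      simp only [Finset.mem_Ico, Finset.mem_Icc]
      omega
    · rw [withConst, if_neg]
      have := (Finset.mem_Icc.1 hn).1
      omega

lemma hasSum_withConst {a b : ℕ → ℝ} (ha : a 0 = 0) {x y c : ℝ}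
    (h : HasSum (fun n : ℕ => a n * Real.cos (2 * Real.pi * n * x) +
      b n * Real.sin (2 * Real.pi * n * x)) (y - c)) :
    HasSum (fun n : ℕ => withConst c a n * Real.cos (2 * Real.pi * n * x) +
      b n * Real.sin (2 * Real.pi * n * x)) y := by
  have h1 := h.add (hasSum_ite_eq (0 : ℕ) c)
  rw [sub_add_cancel] at h1
  refine h1.congr_fun fun n => ?_
  by_cases hn : n = 0
  · subst hn
    simp [withConst, ha]
  · simp [withConst, hn]

lemma eLpNorm_hatPoly_le {R : ℕ} {c : ℝ} {γ δ : ArithmeticFunction ℝ}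
    (hγ : ∀ n, R < n → γ n = 0) (hδ : ∀ n, R < n → δ n = 0) :
    eLpNorm (hatPoly R c γ δ) 2 (volume.restrict (Set.Icc (0 : ℝ) 1)) ≤
      ENNReal.ofReal (dilationConst 0 * coeffNorm R c γ δ) := by
  have hW : 1 ≤ dilationConst 0 := one_le_dilationConst zero_lt_one
  refine eLpNorm_two_le_of_hasSum (a := withConst c (twist oddInd * γ : ArithmeticFunction ℝ))
    (b := (twist oddSign * δ : ArithmeticFunction ℝ))
    (mul_nonneg (by linarith) (coeffNorm_nonneg _ _ _ _)) (fun M => ?_)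
    fun x _ => hasSum_withConst ArithmeticFunction.map_zero (hasSum_hatPoly c γ δ hγ hδ x)
  refine (Finset.sum_le_sum_of_subset_of_nonneg (Finset.range_mono (Nat.le_succ M))
    fun _ _ _ => by positivity).trans ?_
  rw [Nat.succ_eq_add_one, sum_range_withConst _ _ ArithmeticFunction.map_zero]
  have h := energy_twist_le le_rfl zero_lt_one 0 hγ hδ M
  rw [Real.rpow_zero, mul_one, mul_pow, coeffNorm_sq] at h
  rw [mul_pow, coeffNorm_sq]
  have h3 : 1 ≤ dilationConst 0 ^ 2 := one_le_pow₀ hW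
  nlinarith [sq_nonneg c]

/-! ### Stability of sampling on `hatSpace` -/

/-- The sampled norm controls the coefficients on `hatSpace R`. -/
lemma coeffNorm_le_norm_sample {s : ℝ} (hs : 1 / 2 < s) (hs1 : s < 1) {N R m : ℕ} (hR : 1 ≤ R)
    (hm : 1 ≤ m) (hmW : 9 * dilationConst s * ((m : ℝ) ^ s)⁻¹ / (1 - dyadicRatio s) ≤
      1 / (8 * dilationConst 0)) {x : Fin N → ℝ} (hx : WellSpread (604 * (m * R)) x) {c : ℝ}
    {γ δ : ArithmeticFunction ℝ} (hγ : ∀ n, R < n → γ n = 0) (hδ : ∀ n, R < n → δ n = 0) :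
    √N * coeffNorm R c γ δ ≤ 8 * dilationConst 0 * ‖sample x (hatPoly R c γ δ)‖ := by
  set W := dilationConst 0 with hWdef
  have hW : 1 ≤ W := one_le_dilationConst zero_lt_one
  set G := coeffNorm R c γ δ with hGdef
  have hG : 0 ≤ G := coeffNorm_nonneg R c γ δ
  set a : ArithmeticFunction ℝ := twist oddInd * γ with ha
  set b : ArithmeticFunction ℝ := twist oddSign * δ with hb
  set L := m * R with hLdef
  have hL : 1 ≤ L := Nat.mul_pos hm hR
  have hL' : (0 : ℝ) < L := by exact_mod_cast hL
  set u := hatPoly R c γ δ with hu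
  set T := trigPoly (Finset.range (L + 1)) (withConst c a) b with hT
  -- The low frequencies, up to `L = m R`, already carry the coefficient norm.
  have hlow : √N * G / (4 * W) ≤ ‖sample x T‖ := by
    refine (abs_le_of_sq_le_sq' ?_ (norm_nonneg _)).2
    rw [norm_sample_sq]
    have h1 := (sampled_trigPoly (by omega) hx (Finset.range (L + 1)) (withConst c a) b L
      fun n hn => by simpa [Nat.lt_succ_iff] using hn).2 ArithmeticFunction.map_zero
    rw [sum_range_withConst _ _ ArithmeticFunction.map_zero] at h1
    refine le_trans ?_ h1
    -- The number `604` is an integer above `192π`, so that `12πL/Q ≤ 1/16`.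
    have h2 : (1 / 16 : ℝ) ≤ 1 / 8 - 12 * Real.pi * L / ((604 * L : ℕ) : ℝ) := by
      push_cast
      rw [mul_div_mul_right _ _ hL'.ne']
      have := Real.pi_lt_d4
      linarith
    have h3 : G ^ 2 ≤ W ^ 2 * (c ^ 2 + (energy 0 a L + energy 0 b L)) := by
      refine (coeffNorm_sq_le c γ δ).trans ?_
      have hRL : R ≤ L := Nat.le_mul_of_pos_left R hm
      have h4 := energy_mono 0 a hRL
      have h5 := energy_mono 0 b hRL
      gcongr
    set A := c ^ 2 + (energy 0 a L + energy 0 b L)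
    have hA : 0 ≤ A := add_nonneg (sq_nonneg _)
      (add_nonneg (energy_nonneg _ _ _) (energy_nonneg _ _ _))
    calc (√N * G / (4 * W)) ^ 2 = N * (1 / 16) * (G ^ 2 / W ^ 2) := by
          rw [div_pow, mul_pow, mul_pow, Real.sq_sqrt (by positivity)]
          ring
      _ ≤ N * (1 / 16) * A := by
          gcongr
          rw [div_le_iff₀ (by positivity)]
          linarith
      _ ≤ _ := by gcongr
  -- The factor `R ^ s` in the energy of `u` meets `(m R) ^ (-s)` from the tail; only `m ^ (-s)`
  -- remains, and `hmW` makes it small enough to be half of the lower bound.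
  have htail : ‖sample x fun t => u t - T t‖ ≤ √N * G / (8 * W) := by
    have h1 := norm_sample_tail_le (s := s) (F := dilationConst s * (R : ℝ) ^ s * G)
      (a := fun n => if n ≤ L then 0 else a n) (b := fun n => if n ≤ L then 0 else b n)
      (h := fun t => u t - T t) hs
      (mul_nonneg (mul_nonneg (zero_le_one.trans (one_le_dilationConst hs1)) (by positivity)) hG)
      hL (by omega) hx (fun M => ?_) (fun n hn => if_pos hn) (fun n hn => if_pos hn)
      (fun i => ?_)
    · refine h1.trans ?_
      have h2 : (L : ℝ) ^ s = (m : ℝ) ^ s * (R : ℝ) ^ s := by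
        rw [hLdef, Nat.cast_mul, Real.mul_rpow (by positivity) (by positivity)]
      have hRs : (0 : ℝ) < (R : ℝ) ^ s := Real.rpow_pos_of_pos (by exact_mod_cast hR) _
      calc _ = √N * (9 * dilationConst s * ((m : ℝ) ^ s)⁻¹ / (1 - dyadicRatio s) * G) := by
            rw [h2, mul_inv]
            field_simp
        _ ≤ √N * (1 / (8 * W) * G) := by gcongr
        _ = _ := by ring
    · refine le_trans ?_ (energy_twist_le (by linarith) hs1 c hγ hδ M)
      have hcut : ∀ z : ℕ → ℝ, energy s (fun n => if n ≤ L then 0 else z n) M ≤ energy s z M := by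
        intro z
        refine Finset.sum_le_sum fun n _ => mul_le_mul_of_nonneg_left ?_ (by positivity)
        dsimp only
        split_ifs
        · rw [zero_pow two_ne_zero]
          positivity
        · exact le_rfl
      exact add_le_add (hcut a) (hcut b)
    · have h1 := hasSum_withConst ArithmeticFunction.map_zero
        (hasSum_hatPoly c γ δ hγ hδ (x i))
      have h2 := hasSum_sum_of_ne_finset_zero (L := SummationFilter.unconditional ℕ)
        (f := fun n => if n ∈ Finset.range (L + 1) then
        (withConst c a n * Real.cos (2 * Real.pi * n * x i) +
          b n * Real.sin (2 * Real.pi * n * x i)) else 0) (s := Finset.range (L + 1))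
        fun n hn => if_neg hn
      have h3 : ∑ n ∈ Finset.range (L + 1), (if n ∈ Finset.range (L + 1) then
        (withConst c a n * Real.cos (2 * Real.pi * n * x i) +
          b n * Real.sin (2 * Real.pi * n * x i)) else 0) = T (x i) :=
        Finset.sum_congr rfl fun n hn => if_pos hn
      rw [h3] at h2
      refine (h1.sub h2).congr_fun fun n => ?_
      by_cases hn : n ≤ L
      · have : n ∈ Finset.range (L + 1) := Finset.mem_range.2 (by omega)
        rw [if_pos hn, if_pos hn, if_pos this, zero_mul, zero_mul, add_zero]
        exact (sub_self _).symm
      · have h5 : n ∉ Finset.range (L + 1) := by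
          rw [Finset.mem_range]
          omega
        have h6 : n ≠ 0 := by omega
        rw [if_neg hn, if_neg hn, if_neg h5, sub_zero, withConst, if_neg h6]
  have htri : ‖sample x T‖ ≤ ‖sample x u‖ + ‖sample x fun t => u t - T t‖ := by
    have e : sample x T = sample x u - sample x fun t => u t - T t := by
      ext i
      simp [sample]
    rw [e]
    exact norm_sub_le _ _
  have hfin : √N * G / (8 * W) ≤ ‖sample x u‖ := by
    have : √N * G / (4 * W) = √N * G / (8 * W) + √N * G / (8 * W) := by
      field_simp
      ring
    linarith
  rw [div_le_iff₀ (by positivity)] at hfin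
  linarith

/-! ### Interpolation between the uniform norm and `L_2` -/

/-- Interpolation between `L_2` and a uniform bound. -/
lemma eLpNorm_le_interpolation {h : ℝ → ℝ} {A B : ℝ} (hA : 0 ≤ A) (hB : 0 ≤ B)
    (hsup : ∀ t ∈ Set.Icc (0 : ℝ) 1, |h t| ≤ A)
    (h2 : eLpNorm h 2 (volume.restrict (Set.Icc (0 : ℝ) 1)) ≤ ENNReal.ofReal B)
    {p : ℝ≥0∞} (hp : 2 ≤ p) :
    eLpNorm h p (volume.restrict (Set.Icc (0 : ℝ) 1)) ≤
      ENNReal.ofReal (A ^ (1 - 2 * (p⁻¹).toReal) * B ^ (2 * (p⁻¹).toReal)) := by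
  have hae : ∀ᵐ t ∂(volume.restrict (Set.Icc (0 : ℝ) 1)), |h t| ≤ A :=
    (ae_restrict_iff' measurableSet_Icc).2 (Filter.Eventually.of_forall hsup)
  rcases eq_or_ne p ∞ with rfl | hpt
  · simp only [ENNReal.inv_top, ENNReal.toReal_zero, mul_zero, sub_zero, Real.rpow_one,
      Real.rpow_zero, mul_one]
    rw [eLpNorm_exponent_top]
    exact eLpNormEssSup_le_of_ae_bound hae
  have hp0 : p ≠ 0 := (lt_of_lt_of_le (by norm_num) hp).ne'
  set r := p.toReal with hr
  have hr2 : 2 ≤ r := by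
    have := ENNReal.toReal_mono hpt hp
    simpa using this
  have hr0 : 0 < r := by linarith
  have hsq : ∫⁻ t in Set.Icc (0 : ℝ) 1, ‖h t‖ₑ ^ (2 : ℝ) ≤ ENNReal.ofReal B ^ (2 : ℝ) := by
    rw [eLpNorm_eq_lintegral_rpow_enorm_toReal two_ne_zero ENNReal.ofNat_ne_top,
      ENNReal.toReal_ofNat] at h2
    have := ENNReal.rpow_le_rpow h2 zero_le_two
    rwa [← ENNReal.rpow_mul, one_div, inv_mul_cancel₀ two_ne_zero, ENNReal.rpow_one] at this
  have hmain : ∫⁻ t in Set.Icc (0 : ℝ) 1, ‖h t‖ₑ ^ r ≤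
      ENNReal.ofReal A ^ (r - 2) * ENNReal.ofReal B ^ (2 : ℝ) := by
    calc _ ≤ ∫⁻ t in Set.Icc (0 : ℝ) 1, ENNReal.ofReal A ^ (r - 2) * ‖h t‖ₑ ^ (2 : ℝ) := by
          refine lintegral_mono_ae (hae.mono fun t ht => ?_)
          have e : ‖h t‖ₑ ^ r = ‖h t‖ₑ ^ (r - 2) * ‖h t‖ₑ ^ (2 : ℝ) := by
            rw [← ENNReal.rpow_add_of_nonneg _ _ (by linarith) (by norm_num), sub_add_cancel]
          rw [e]
          gcongr
          rw [← ofReal_norm]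
          exact ENNReal.ofReal_le_ofReal ht
      _ = ENNReal.ofReal A ^ (r - 2) * ∫⁻ t in Set.Icc (0 : ℝ) 1, ‖h t‖ₑ ^ (2 : ℝ) :=
          lintegral_const_mul' _ _
            (ENNReal.rpow_ne_top_of_nonneg (by linarith) ENNReal.ofReal_ne_top)
      _ ≤ _ := by gcongr
  rw [eLpNorm_eq_lintegral_rpow_enorm_toReal hp0 hpt]
  refine (ENNReal.rpow_le_rpow hmain (by positivity)).trans_eq ?_
  rw [ENNReal.mul_rpow_of_nonneg _ _ (by positivity), ← ENNReal.rpow_mul, ← ENNReal.rpow_mul,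
    ENNReal.ofReal_rpow_of_nonneg hA (mul_nonneg (by linarith) (by positivity)),
    ENNReal.ofReal_rpow_of_nonneg hB (by positivity), ← ENNReal.ofReal_mul (by positivity),
    ENNReal.toReal_inv, ← hr]
  congr 3
  · field_simp
  · field_simp

lemma eLpNorm_le_of_rates {h : ℝ → ℝ} {X ρ s : ℝ} (hX : 0 ≤ X) (hρ : 0 < ρ)
    (hsup : ∀ t ∈ Set.Icc (0 : ℝ) 1, |h t| ≤ X * ρ ^ (1 / 2 - s))
    (h2 : eLpNorm h 2 (volume.restrict (Set.Icc (0 : ℝ) 1)) ≤ ENNReal.ofReal (X * ρ ^ (-s)))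
    {p : ℝ≥0∞} (hp : 2 ≤ p) :
    eLpNorm h p (volume.restrict (Set.Icc (0 : ℝ) 1)) ≤
      ENNReal.ofReal (X * ρ ^ (-s + 1 / 2 - (p⁻¹).toReal)) := by
  refine (eLpNorm_le_interpolation (by positivity) (by positivity) hsup h2 hp).trans_eq ?_
  congr 1
  set θ := (p⁻¹).toReal with hθ
  have h0 : 0 ≤ θ := ENNReal.toReal_nonneg
  have h1 : θ ≤ 1 / 2 := by
    have := ENNReal.toReal_mono (by simp) (ENNReal.inv_le_inv.2 hp)
    simpa [hθ] using this
  rw [Real.mul_rpow hX (by positivity), Real.mul_rpow hX (by positivity), ← Real.rpow_mul hρ.le,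
    ← Real.rpow_mul hρ.le]
  have e1 : X ^ (1 - 2 * θ) * X ^ (2 * θ) = X := by
    rw [← Real.rpow_add_of_nonneg hX (by linarith) (by linarith), sub_add_cancel, Real.rpow_one]
  have e2 : ρ ^ ((1 / 2 - s) * (1 - 2 * θ)) * ρ ^ (-s * (2 * θ)) = ρ ^ (-s + 1 / 2 - θ) := by
    rw [← Real.rpow_add hρ]
    congr 1
    ring
  rw [← e2]
  nth_rewrite 3 [← e1]
  ring

/-! ### Approximation of Sobolev functions from `hatSpace` -/

/-- The Fourier coefficients of positive frequency as an arithmetic function. -/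
def positivePart (a : ℕ → ℝ) : ArithmeticFunction ℝ where
  toFun n := if n = 0 then 0 else a n
  map_zero' := by simp

lemma positivePart_apply (a : ℕ → ℝ) {n : ℕ} (hn : n ≠ 0) : positivePart a n = a n := if_neg hn

lemma sobolevNorm_nonneg (s : ℝ) (f : ℝ → ℝ) : 0 ≤ sobolevNorm s f := Real.sqrt_nonneg _

lemma MemSobolev.energy_le {s : ℝ} {f : ℝ → ℝ} (hf : MemSobolev s f) (M : ℕ) :
    energy s (positivePart (cosCoeff f)) M + energy s (positivePart (sinCoeff f)) M ≤
      sobolevNorm s f ^ 2 := by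
  have h0 : ∀ m : ℕ, 0 ≤ sobolevTerm s f (m + 1) := fun m => by unfold sobolevTerm; positivity
  have e : energy s (positivePart (cosCoeff f)) M + energy s (positivePart (sinCoeff f)) M =
      ∑ m ∈ Finset.range M, sobolevTerm s f (m + 1) := by
    rw [energy, energy, ← Finset.sum_add_distrib, Finset.range_eq_Ico,
      Finset.sum_Ico_add' (fun m => sobolevTerm s f m)]
    refine Finset.sum_congr ?_ fun n hn => ?_
    · ext n
      simp only [Finset.mem_Ico, Finset.mem_Icc]
      omega
    · have : n ≠ 0 := by
        have := (Finset.mem_Ico.1 hn).1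
        omega
      rw [positivePart_apply _ this, positivePart_apply _ this, sobolevTerm]
      ring
  rw [e, sobolevNorm, Real.sq_sqrt (add_nonneg (sq_nonneg _) (tsum_nonneg h0))]
  have := hf.summable.sum_le_tsum (Finset.range M) fun m _ => h0 m
  linarith [sq_nonneg (meanCoeff f)]

lemma MemSobolev.hasSum_positivePart {s : ℝ} {f : ℝ → ℝ} (hf : MemSobolev s f) {x : ℝ}
    (hx : x ∈ Set.Icc (0 : ℝ) 1) :
    HasSum (fun n : ℕ => positivePart (cosCoeff f) n * Real.cos (2 * Real.pi * n * x) +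
      positivePart (sinCoeff f) n * Real.sin (2 * Real.pi * n * x)) (f x - meanCoeff f) := by
  have h := hf.hasSum x hx
  rw [← hasSum_nat_add_iff' 1]
  simp only [Finset.sum_range_one, ArithmeticFunction.map_zero, zero_mul, add_zero, sub_zero]
  refine h.congr_fun fun n => ?_
  rw [positivePart_apply _ (Nat.succ_ne_zero n), positivePart_apply _ (Nat.succ_ne_zero n)]

/-- Truncation at `R` is invisible at `n ≤ R`, since every divisor of `n` is at most `R`. -/
lemma twist_mul_truncate_apply (χ : ℕ →*₀ ℤ) (a : ArithmeticFunction ℝ) {R n : ℕ} (hn : n ≤ R) :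
    (twist χ * truncate R (twistInv χ * a)) n = a n := by
  have e : twist χ * (twistInv χ * a) = a := by
    rw [← mul_assoc, twist_mul_twistInv, one_mul]
  conv_rhs => rw [← e]
  rw [ArithmeticFunction.mul_apply, ArithmeticFunction.mul_apply]
  refine Finset.sum_congr rfl fun p hp => ?_
  rw [truncate_apply, if_pos
    ((Nat.divisor_le (Nat.snd_mem_divisors_of_mem_antidiagonal hp)).trans hn)]

lemma energy_twist_truncate_le {s : ℝ} (hs1 : s < 1) (χ : ℕ →*₀ ℤ) (hχ : ∀ j, |χ j| ≤ 1)
    (a : ArithmeticFunction ℝ) (R M : ℕ) :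
    energy s (twist χ * truncate R (twistInv χ * a) : ArithmeticFunction ℝ) M ≤
      dilationConst s ^ 4 * energy s a M := by
  have h1 := energy_convolution_le hs1 (twist χ) (truncate R (twistInv χ * a))
    (abs_twist_le χ hχ) M
  have h2 := energy_convolution_le hs1 (twistInv χ) a (abs_twistInv_le χ hχ) M
  have h3 : energy s (truncate R (twistInv χ * a)) M ≤
      energy s (twistInv χ * a : ArithmeticFunction ℝ) M := by
    refine Finset.sum_le_sum fun n _ => mul_le_mul_of_nonneg_left ?_ (by positivity)
    rw [truncate_apply]
    split_ifs
    · exact le_rfl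
    · rw [zero_pow two_ne_zero]
      positivity
  calc _ ≤ _ := h1
    _ ≤ dilationConst s ^ 2 * (dilationConst s ^ 2 * energy s a M) := by
        gcongr
        exact h3.trans h2
    _ = _ := by ring

lemma energy_sub_le (s : ℝ) (a b : ℕ → ℝ) (M : ℕ) :
    energy s (fun n => a n - b n) M ≤ 2 * energy s a M + 2 * energy s b M := by
  rw [energy, energy, energy, Finset.mul_sum, Finset.mul_sum, ← Finset.sum_add_distrib]
  refine Finset.sum_le_sum fun n _ => ?_
  have h : (a n - b n) ^ 2 ≤ 2 * a n ^ 2 + 2 * b n ^ 2 := by nlinarith [sq_nonneg (a n + b n)]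
  have := mul_le_mul_of_nonneg_left h (show 0 ≤ (n : ℝ) ^ (2 * s) by positivity)
  linarith

lemma continuous_hatCos : Continuous hatCos := by
  have h : hatCos = fun x => 4 * |Int.fract x - 1 / 2| - 1 := rfl
  have h1 : Continuous ((fun y : ℝ => 4 * |y - 1 / 2| - 1) ∘ (Int.fract : ℝ → ℝ)) :=
    ContinuousOn.comp_fract'' (by fun_prop) (by norm_num)
  exact h1

lemma continuous_hatSin : Continuous hatSin := by
  rw [show hatSin = fun x => hatCos (x - 1 / 4) from funext hatSin_eq]
  exact continuous_hatCos.comp (by fun_prop)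

lemma continuous_hatPoly (R : ℕ) (c : ℝ) (γ δ : ℕ → ℝ) : Continuous (hatPoly R c γ δ) := by
  have hc := continuous_hatCos
  have hsn := continuous_hatSin
  unfold hatPoly
  fun_prop

/-- Approximation of a Sobolev function by the expansion with respect to the generators of
`hatSpace R`, in the uniform norm, in `L_2` and on well-spread samples. -/
lemma MemSobolev.exists_approx {s : ℝ} (hs : 1 / 2 < s) (hs1 : s < 1) {f : ℝ → ℝ}
    (hf : MemSobolev s f) {R : ℕ} (hR : 1 ≤ R) :
    ∃ q ∈ hatSpace R,
      (∀ t ∈ Set.Icc (0 : ℝ) 1, |f t - q t| ≤ √R * ((R : ℝ) ^ s)⁻¹ *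
        (2 * dilationConst s ^ 2 * sobolevNorm s f) / (1 - dyadicRatio s)) ∧
      eLpNorm (fun t => f t - q t) 2 (volume.restrict (Set.Icc (0 : ℝ) 1)) ≤
        ENNReal.ofReal (((R : ℝ) ^ s)⁻¹ * (2 * dilationConst s ^ 2 * sobolevNorm s f)) ∧
      ∀ (N Q : ℕ) (x : Fin N → ℝ), R ≤ Q → WellSpread Q x →
        ‖sample x (fun t => f t - q t)‖ ≤ √N * (9 * ((R : ℝ) ^ s)⁻¹ *
          (2 * dilationConst s ^ 2 * sobolevNorm s f) / (1 - dyadicRatio s)) := by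
  set F := sobolevNorm s f with hFdef
  have hF : 0 ≤ F := sobolevNorm_nonneg s f
  have hW : 1 ≤ dilationConst s := one_le_dilationConst hs1
  set a := positivePart (cosCoeff f) with ha
  set b := positivePart (sinCoeff f) with hb
  set γ := truncate R (twistInv oddInd * a) with hγ
  set δ := truncate R (twistInv oddSign * b) with hδ
  have hγ0 : ∀ n, R < n → γ n = 0 := fun n hn => if_neg (not_le.2 hn)
  have hδ0 : ∀ n, R < n → δ n = 0 := fun n hn => if_neg (not_le.2 hn)
  set α : ℕ → ℝ := fun n => a n - (twist oddInd * γ) n with hα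
  set β : ℕ → ℝ := fun n => b n - (twist oddSign * δ) n with hβ
  have hα0 : ∀ n ≤ R, α n = 0 := fun n hn => by
    rw [hα, hγ]
    simp only
    rw [twist_mul_truncate_apply _ _ hn, sub_self]
  have hβ0 : ∀ n ≤ R, β n = 0 := fun n hn => by
    rw [hβ, hδ]
    simp only
    rw [twist_mul_truncate_apply _ _ hn, sub_self]
  have hsum : ∀ t ∈ Set.Icc (0 : ℝ) 1, HasSum (fun n : ℕ => α n * Real.cos (2 * Real.pi * n * t) +
      β n * Real.sin (2 * Real.pi * n * t)) (f t - hatPoly R (meanCoeff f) γ δ t) := by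
    intro t ht
    have h := (hf.hasSum_positivePart ht).sub (hasSum_hatPoly (meanCoeff f) γ δ hγ0 hδ0 t)
    rw [sub_sub_sub_cancel_right] at h
    refine h.congr_fun fun n => ?_
    simp only [hα, hβ]
    ring
  -- The whole difference has energy at most `(2 + 2 w⁴) F² ≤ 4 w⁴ F²` with `w = dilationConst s ≥
  -- 1`; since it vanishes up to `R`, all three estimates are tail bounds with this one constant.
  have hen : ∀ M, energy s α M + energy s β M ≤ (2 * dilationConst s ^ 2 * F) ^ 2 := by
    intro M
    have h1 := energy_sub_le s a (twist oddInd * γ : ArithmeticFunction ℝ) M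
    have h2 := energy_sub_le s b (twist oddSign * δ : ArithmeticFunction ℝ) M
    have h3 := energy_twist_truncate_le hs1 oddInd abs_oddInd_le a R M
    have h4 := energy_twist_truncate_le hs1 oddSign abs_oddSign_le b R M
    have h5 : energy s a M + energy s b M ≤ F ^ 2 := hf.energy_le M
    have h6 : 1 ≤ dilationConst s ^ 4 := one_le_pow₀ hW
    have h7 := mul_le_mul_of_nonneg_left h5 (show 0 ≤ dilationConst s ^ 4 by positivity)
    have h8 : F ^ 2 ≤ dilationConst s ^ 4 * F ^ 2 := le_mul_of_one_le_left (sq_nonneg _) h6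
    calc _ ≤ (2 * energy s a M + 2 * (dilationConst s ^ 4 * energy s a M)) +
          (2 * energy s b M + 2 * (dilationConst s ^ 4 * energy s b M)) := by
          refine add_le_add (h1.trans ?_) (h2.trans ?_)
          · linarith
          · linarith
      _ ≤ _ := by nlinarith
  have hF' : 0 ≤ 2 * dilationConst s ^ 2 * F := by positivity
  refine ⟨hatPoly R (meanCoeff f) γ δ, hatPoly_mem _ _ _ _, fun t ht => ?_, ?_,
    fun N Q x hQ hx => ?_⟩
  · exact abs_tail_le hs hF' hR hen hα0 hβ0 (hsum t ht)
  · refine eLpNorm_two_le_of_hasSum (by positivity) (fun M => ?_) hsum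
    refine le_trans ?_ (sum_block_le (n := M) (by linarith) hen hR)
    rw [← Finset.sum_filter_add_sum_filter_not _ (fun n => n ≤ R), Finset.sum_eq_zero, zero_add]
    · refine Finset.sum_le_sum_of_subset_of_nonneg ?_ fun _ _ _ => by positivity
      intro n hn
      rw [Finset.mem_filter, Finset.mem_range] at hn
      rw [Finset.mem_Ioc]
      omega
    · intro n hn
      have := (Finset.mem_filter.1 hn).2
      simp [hα0 n this, hβ0 n this]
  · exact norm_sample_tail_le hs hF' hR hQ hx hen hα0 hβ0
      fun i => hsum _ (Set.Ico_subset_Icc_self (hx.1 i))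

/-! ### Least squares -/

/-- Evaluation at the sampling points as a linear map. -/
def sampleMap {N : ℕ} (x : Fin N → ℝ) : (ℝ → ℝ) →ₗ[ℝ] EuclideanSpace ℝ (Fin N) where
  toFun := sample x
  map_add' _ _ := rfl
  map_smul' _ _ := rfl

lemma sampleMap_apply {N : ℕ} (x : Fin N → ℝ) (h : ℝ → ℝ) : sampleMap x h = sample x h := rfl

lemma isLeastSquares_iff {V : Submodule ℝ (ℝ → ℝ)} {N : ℕ} {x : Fin N → ℝ} {f g : ℝ → ℝ} :
    IsLeastSquares V x f g ↔ g ∈ V ∧ ∀ h ∈ V, ‖sample x (g - f)‖ ≤ ‖sample x (h - f)‖ := by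
  have e : ∀ h : ℝ → ℝ, ∑ i, |h (x i) - f (x i)| ^ 2 = ‖sample x (h - f)‖ ^ 2 := fun h => by
    rw [norm_sample_sq]
    simp
  unfold IsLeastSquares
  simp_rw [e, sq_le_sq₀ (norm_nonneg _) (norm_nonneg _)]

/-- A minimizer is any preimage in `V` of the orthogonal projection of the data onto the sampled
space. -/
lemma exists_isLeastSquares (V : Submodule ℝ (ℝ → ℝ)) {N : ℕ} (x : Fin N → ℝ) (f : ℝ → ℝ) :
    ∃ g, IsLeastSquares V x f g := by
  set U := V.map (sampleMap x)
  obtain ⟨g, hg, hgP⟩ := Submodule.mem_map.1 (U.starProjection_apply_mem (sample x f))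
  refine ⟨g, isLeastSquares_iff.2 ⟨hg, fun h hh => ?_⟩⟩
  have e : ∀ k : ℝ → ℝ, ‖sample x (k - f)‖ = ‖sample x f - sampleMap x k‖ := fun k => by
    rw [norm_sub_rev, ← sampleMap_apply, ← sampleMap_apply, map_sub]
  rw [e, e, hgP, Submodule.starProjection_minimal]
  exact ciInf_le ⟨0, Set.forall_mem_range.2 fun _ => norm_nonneg _⟩
    (⟨sampleMap x h, Submodule.mem_map_of_mem hh⟩ : U)

/-- The midpoint of two minimizers would do better unless they agree at the points, by the
parallelogram law. -/
lemma IsLeastSquares.sample_eq {V : Submodule ℝ (ℝ → ℝ)} {N : ℕ} {x : Fin N → ℝ} {f g h : ℝ → ℝ}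
    (hg : IsLeastSquares V x f g) (hh : IsLeastSquares V x f h) : sample x (h - g) = 0 := by
  rw [isLeastSquares_iff] at hg hh
  have h1 := hg.2 ((1 / 2 : ℝ) • (g + h))
    (V.smul_mem _ (V.add_mem hg.1 hh.1))
  have h2 := hh.2 g hg.1
  have h3 := hg.2 h hh.1
  set u := sample x (g - f) with hu
  set v := sample x (h - f) with hv
  have e1 : sample x ((1 / 2 : ℝ) • (g + h) - f) = (1 / 2 : ℝ) • (u + v) := by
    ext i
    simp [sample, hu, hv]
    ring
  have e2 : sample x (h - g) = v - u := by
    ext i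
    simp [sample, hu, hv]
  rw [e1, norm_smul] at h1
  have hpar := parallelogram_law_with_norm ℝ v u
  rw [add_comm v u] at hpar
  have h4 : ‖u‖ = ‖v‖ := le_antisymm h3 h2
  norm_num at h1
  have h5 : ‖v - u‖ * ‖v - u‖ ≤ 0 := by nlinarith [norm_nonneg u, norm_nonneg (u + v)]
  rw [e2, ← norm_eq_zero]
  nlinarith [norm_nonneg (v - u)]

/-- The constant in the error bounds. -/
def errorConst (s : ℝ) : ℝ :=
  2 * dilationConst s ^ 2 / (1 - dyadicRatio s) +
    (5 + dilationConst 0) * (288 * dilationConst 0 * dilationConst s ^ 2 / (1 - dyadicRatio s))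

/-- Existence, uniqueness and error of the least squares solution on well-spread points. -/
lemma leastSquares_of_wellSpread {s : ℝ} (hs : 1 / 2 < s) (hs1 : s < 1) {N R m : ℕ} (hN : 0 < N)
    (hR : 1 ≤ R) (hm : 1 ≤ m) (hmW : 9 * dilationConst s * ((m : ℝ) ^ s)⁻¹ / (1 - dyadicRatio s) ≤
      1 / (8 * dilationConst 0)) {x : Fin N → ℝ} (hx : WellSpread (604 * (m * R)) x) {f : ℝ → ℝ}
    (hf : MemSobolev s f) :
    ∃ g, IsLeastSquares (hatSpace R) x f g ∧
      (∀ h, IsLeastSquares (hatSpace R) x f h → h = g) ∧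
      (∀ t ∈ Set.Icc (0 : ℝ) 1,
        |f t - g t| ≤ errorConst s * sobolevNorm s f * (R : ℝ) ^ (1 / 2 - s)) ∧
      eLpNorm (fun t => f t - g t) 2 (volume.restrict (Set.Icc (0 : ℝ) 1)) ≤
        ENNReal.ofReal (errorConst s * sobolevNorm s f * (R : ℝ) ^ (-s)) := by
  have hR0 : (0 : ℝ) < R := by exact_mod_cast hR
  have hsN : 0 < √(N : ℝ) := Real.sqrt_pos.2 (by exact_mod_cast hN)
  set W := dilationConst 0 with hWdef
  have hW : 1 ≤ W := one_le_dilationConst zero_lt_one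
  set F := sobolevNorm s f with hFdef
  have hF : 0 ≤ F := sobolevNorm_nonneg s f
  have hr0 := dyadicRatio_nonneg s
  have hr1 := dyadicRatio_lt_one hs
  set w := dilationConst s with hw
  set σ := (1 - dyadicRatio s)⁻¹ with hσ
  have hσ1 : 1 ≤ σ := (one_le_inv₀ (by linarith)).2 (by linarith)
  set τ := ((R : ℝ) ^ s)⁻¹ with hτ
  have hτ0 : 0 ≤ τ := by positivity
  have hD : errorConst s = 2 * w ^ 2 * σ + (5 + W) * (288 * W * w ^ 2 * σ) := by
    rw [errorConst, div_eq_mul_inv, div_eq_mul_inv]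
  set K := 288 * W * w ^ 2 * σ with hK
  have hK0 : 0 ≤ K := by positivity
  have hsupexp : √R * τ = (R : ℝ) ^ (1 / 2 - s) := by
    rw [Real.rpow_sub hR0, Real.sqrt_eq_rpow, hτ, ← div_eq_mul_inv]
  have hτexp : τ = (R : ℝ) ^ (-s) := by rw [Real.rpow_neg hR0.le]
  obtain ⟨q, hq, hqsup, hq2, hqs⟩ := hf.exists_approx hs hs1 hR
  obtain ⟨g, hg⟩ := exists_isLeastSquares (hatSpace R) x f
  have hcont : ∀ v ∈ hatSpace R, Continuous v := by
    intro v hv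
    obtain ⟨c, γ, δ, -, -, rfl⟩ := exists_hatPoly hv
    exact continuous_hatPoly _ _ _ _
  refine ⟨g, hg, fun h hh => ?_, ?_⟩
  -- The difference of two minimizers has zero samples, hence zero coefficients by stability, hence
  -- vanishes on all of `ℝ`.
  · have h0 := hg.sample_eq hh
    obtain ⟨c, γ, δ, hγ, hδ, e⟩ := exists_hatPoly (Submodule.sub_mem _ hh.1 hg.1)
    have h1 := coeffNorm_le_norm_sample hs hs1 hR hm hmW hx (c := c) hγ hδ
    rw [← e, h0, norm_zero, mul_zero] at h1
    have h2 : coeffNorm R c γ δ = 0 := by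
      have := coeffNorm_nonneg R c γ δ
      nlinarith
    ext t
    have h3 := abs_hatPoly_le hR c γ δ t
    rw [h2, mul_zero, ← e] at h3
    have := abs_nonpos_iff.1 h3
    rw [Pi.sub_apply] at this
    linarith
  obtain ⟨c, γ, δ, hγ, hδ, e⟩ := exists_hatPoly (Submodule.sub_mem _ hq hg.1)
  have hG0 := coeffNorm_nonneg R c γ δ
  have hG : coeffNorm R c γ δ ≤ K * (τ * F) := by
    have h1 := coeffNorm_le_norm_sample hs hs1 hR hm hmW hx (c := c) hγ hδ
    rw [← e] at h1
    have h2 := hqs N _ x (by nlinarith) hx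
    have h3 := (isLeastSquares_iff.1 hg).2 q hq
    have h4 : ‖sample x (q - f)‖ = ‖sample x fun t => f t - q t‖ := by
      rw [← norm_neg]
      congr 1
      ext i
      simp [sample]
    have h5 : ‖sample x (q - g)‖ ≤ ‖sample x (q - f)‖ + ‖sample x (g - f)‖ := by
      have : sample x (q - g) = sample x (q - f) - sample x (g - f) := by
        ext i
        simp [sample]
      rw [this]
      exact norm_sub_le _ _
    -- Minimality of `g` gives the factor 2; with the `8 W` of stability, `8 · 2 · 9 · 2 = 288`.
    have h6 : ‖sample x (q - g)‖ ≤ 2 * (√N * (9 * τ * (2 * w ^ 2 * F) * σ)) := by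
      rw [div_eq_mul_inv] at h2
      linarith
    have h7 : √N * coeffNorm R c γ δ ≤ √N * (K * (τ * F)) :=
      h1.trans ((mul_le_mul_of_nonneg_left h6 (by positivity)).trans_eq (by rw [hK]; ring))
    exact le_of_mul_le_mul_left h7 hsN
  constructor
  · intro t ht
    have h1 := hqsup t ht
    have h2 := abs_hatPoly_le hR c γ δ t
    rw [← e, Pi.sub_apply] at h2
    have h3 : |f t - g t| ≤ |f t - q t| + |q t - g t| := abs_sub_le _ _ _
    have h4 := mul_le_mul_of_nonneg_left hG (show 0 ≤ 5 * √(R : ℝ) by positivity)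
    rw [← hsupexp, hD]
    rw [div_eq_mul_inv] at h1
    have h5 : 0 ≤ W * K * F * (√R * τ) := by positivity
    linarith
  · have h1 : (fun t => f t - g t) = (fun t => f t - q t) + (q - g) := by
      ext t
      simp
    have hmf : AEStronglyMeasurable (fun t => f t - q t) (volume.restrict (Set.Icc (0 : ℝ) 1)) :=
      hf.memLp.aestronglyMeasurable.sub (hcont q hq).aestronglyMeasurable
    have hmq : AEStronglyMeasurable (q - g) (volume.restrict (Set.Icc (0 : ℝ) 1)) :=
      ((hcont q hq).sub (hcont g hg.1)).aestronglyMeasurable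
    have h2 := eLpNorm_hatPoly_le (c := c) hγ hδ
    rw [← e] at h2
    rw [h1]
    refine (eLpNorm_add_le hmf hmq one_le_two).trans ((add_le_add hq2 h2).trans ?_)
    rw [← ENNReal.ofReal_add (by positivity) (by positivity)]
    refine ENNReal.ofReal_le_ofReal ?_
    rw [← hτexp, hD]
    have h3 : W * coeffNorm R c γ δ ≤ W * (K * (τ * F)) :=
      mul_le_mul_of_nonneg_left hG (by positivity)
    have h4 : τ * (2 * w ^ 2 * F) ≤ τ * (2 * w ^ 2 * F) * σ :=
      le_mul_of_one_le_right (by positivity) hσ1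
    have h5 : 0 ≤ 5 * K * F * τ := by positivity
    linarith

/-! ### Comparison of rates, and choice of constants -/

/-- `N ≥ C R log R` with large `C` implies `N ≥ A R log N`, for large `N`. -/
lemma mul_log_le_of_mul_log_le {A C R N : ℝ} (hA : 0 ≤ A) (hC2 : 2 * A ≤ C) (hC8 : (4 * A) ^ 8 ≤ C)
    (hR : 1 ≤ R) (hN : 1 ≤ N) (h : C * R * Real.log R ≤ N) (hCN : C ≤ N ^ 2) :
    A * R * Real.log N ≤ N := by
  have hN0 : 0 < N := by linarith
  have hlogN : 0 ≤ Real.log N := Real.log_nonneg hN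
  -- If `R² ≤ N`, then `R log N ≤ 4 N ^ (3/4)` and largeness of `N` suffices; otherwise `log N ≤ 2
  -- log R` and the hypothesis on `R log R` applies.
  rcases le_or_gt (R ^ 2) N with hRN | hRN
  · set y := N ^ (1 / 4 : ℝ) with hy
    have hy0 : 0 ≤ y := by positivity
    have hy4 : y ^ 4 = N := by
      rw [hy, ← Real.rpow_natCast, ← Real.rpow_mul hN0.le]
      norm_num
    have h1 : Real.log N ≤ 4 * y := by
      have := Real.log_le_rpow_div hN0.le (show (0 : ℝ) < 1 / 4 by norm_num)
      linarith
    have h2 : R ≤ y ^ 2 := by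
      refine (abs_le_of_sq_le_sq' ?_ (by positivity)).2
      rw [← pow_mul, hy4]
      exact hRN
    have h3 : 4 * A ≤ y := by
      refine le_of_pow_le_pow_left₀ (n := 8) (by norm_num) hy0 ?_
      calc _ ≤ C := hC8
        _ ≤ N ^ 2 := hCN
        _ = y ^ 8 := by rw [← hy4]; ring
    calc A * R * Real.log N ≤ A * y ^ 2 * (4 * y) := by
          gcongr
      _ = 4 * A * y ^ 3 := by ring
      _ ≤ y * y ^ 3 := by gcongr
      _ = N := by rw [← hy4]; ring
  · have h1 : Real.log N ≤ 2 * Real.log R := by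
      have := Real.log_le_log hN0 hRN.le
      rw [Real.log_pow] at this
      exact_mod_cast this
    have hlog : 0 ≤ Real.log R := Real.log_nonneg hR
    calc A * R * Real.log N ≤ A * R * (2 * Real.log R) := by gcongr
      _ = 2 * A * (R * Real.log R) := by ring
      _ ≤ C * (R * Real.log R) := by gcongr
      _ ≤ N := by linarith

/-- If `N` and `R log R` are comparable, then so are the rates in `R` and in `N / log N`. -/
lemma rpow_le_mul_rpow_of_comparable {C K R N α : ℝ} (hC : 2 ≤ C) (hR : R = 1 ∨ 2 ≤ R) (hN : 2 ≤ N)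
    (h : C * R * Real.log R ≤ N) (hK : N ≤ K * R * Real.log R) (hα0 : 0 ≤ α) (hα1 : α ≤ 1) :
    R ^ (-α) ≤ max 1 K * (N / Real.log N) ^ (-α) := by
  -- For `R = 1` the upper bound on `N` would read `N ≤ 0`.
  rcases hR with rfl | hR
  · simp at hK
    linarith
  have hlogR : 1 / 2 ≤ Real.log R := by
    have h1 := Real.log_le_log (by norm_num) hR
    have h2 := Real.log_two_gt_d9
    linarith
  have hRN : R ≤ N := by
    calc R = 2 * R * (1 / 2) := by ring
      _ ≤ C * R * Real.log R := by gcongr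
      _ ≤ N := h
  have hlog : Real.log R ≤ Real.log N := Real.log_le_log (by linarith) hRN
  have hlogN : 0 < Real.log N := by linarith
  have hR0 : 0 < R := by linarith
  have hN0 : 0 < N := by linarith
  set k := max 1 K with hk
  have hk1 : 1 ≤ k := le_max_left _ _
  have hy : N / Real.log N ≤ k * R := by
    rw [div_le_iff₀ hlogN]
    calc N ≤ K * R * Real.log R := hK
      _ ≤ k * R * Real.log N := by
        gcongr
        exact le_max_right _ _
  have hy0 : 0 < N / Real.log N := by positivity
  have h1 : (N / Real.log N) ^ α ≤ k * R ^ α := by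
    calc _ ≤ (k * R) ^ α := Real.rpow_le_rpow hy0.le hy hα0
      _ = k ^ α * R ^ α := Real.mul_rpow (by linarith) hR0.le
      _ ≤ k ^ (1 : ℝ) * R ^ α := by gcongr
      _ = _ := by rw [Real.rpow_one]
  rw [Real.rpow_neg hR0.le, Real.rpow_neg hy0.le, ← div_eq_mul_inv,
    le_div_iff₀ (Real.rpow_pos_of_pos hy0 _), ← div_eq_inv_mul,
    div_le_iff₀ (Real.rpow_pos_of_pos hR0 _)]
  exact h1

lemma exists_cutoff {s : ℝ} (hs : 0 < s) (B : ℝ) {ε : ℝ} (hε : 0 < ε) :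
    ∃ m : ℕ, 1 ≤ m ∧ B * ((m : ℝ) ^ s)⁻¹ ≤ ε := by
  have h1 : Filter.Tendsto (fun m : ℕ => B * ((m : ℝ) ^ s)⁻¹) Filter.atTop (nhds (B * 0)) :=
    (((tendsto_rpow_atTop hs).comp tendsto_natCast_atTop_atTop).inv_tendsto_atTop).const_mul B
  rw [mul_zero] at h1
  obtain ⟨m, hm, hm'⟩ :=
    ((h1.eventually (ge_mem_nhds hε)).and (Filter.eventually_ge_atTop 1)).exists
  exact ⟨m, hm', hm⟩

end PLSampling

end

theorem mainTheorem10 (s : ℝ) (hs : 1 / 2 < s) (hs1 : s < 1) :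
    ∃ C : ℕ, 0 < C ∧ ∃ C' : ℝ → ℕ,
      ∀ R N : ℕ, 1 ≤ R → 2 ≤ N → (C : ℝ) * R * Real.log R ≤ N →
        ∃ E : Set (Fin N → ℝ), MeasurableSet E ∧
          1 - (C : ℝ) / (N : ℝ) ^ 2 ≤ (PLSampling.uniformPoints N).real E ∧
          ∀ x ∈ E, ∀ f : ℝ → ℝ, PLSampling.MemSobolev s f →
            ∃ g : ℝ → ℝ,
              PLSampling.IsLeastSquares (PLSampling.hatSpace R) x f g ∧
              (∀ h : ℝ → ℝ,
                PLSampling.IsLeastSquares (PLSampling.hatSpace R) x f h → h = g) ∧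
              ∀ p : ℝ≥0∞, 2 ≤ p →
                eLpNorm (fun t => f t - g t) p (volume.restrict (Set.Icc (0 : ℝ) 1)) ≤
                  ENNReal.ofReal (C * (R : ℝ) ^ (-s + 1 / 2 - (p⁻¹).toReal) *
                    PLSampling.sobolevNorm s f) ∧
                (∀ K : ℝ, (N : ℝ) ≤ K * R * Real.log R →
                  eLpNorm (fun t => f t - g t) p (volume.restrict (Set.Icc (0 : ℝ) 1)) ≤
                    ENNReal.ofReal
                      (C' K * ((N : ℝ) / Real.log N) ^ (-s + 1 / 2 - (p⁻¹).toReal) *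
                        PLSampling.sobolevNorm s f)) := by
  open PLSampling in
  have hW : 1 ≤ dilationConst 0 := one_le_dilationConst zero_lt_one
  obtain ⟨m, hm, hmW⟩ := exists_cutoff (s := s) (by linarith)
    (9 * dilationConst s / (1 - dyadicRatio s))
    (show 0 < 1 / (8 * dilationConst 0) by positivity)
  rw [div_mul_eq_mul_div] at hmW
  have hD0 : 0 ≤ errorConst s := by
    have := sub_pos.2 (dyadicRatio_lt_one hs)
    unfold errorConst
    positivity
  -- With `Q = 604 m R` cells, `A R log N ≤ N` is the hypothesis of `real_wellSpread_ge`.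
  set A : ℝ := 24 * (604 * m) with hA
  have hA0 : 0 ≤ A := by positivity
  set C : ℕ := ⌈2 + 2 * A + (4 * A) ^ 8 + errorConst s⌉₊ with hCdef
  have hC : 2 + 2 * A + (4 * A) ^ 8 + errorConst s ≤ C := Nat.le_ceil _
  have hA8 : 0 ≤ (4 * A) ^ 8 := by positivity
  have hC2 : (2 : ℝ) ≤ C := by linarith
  refine ⟨C, by exact_mod_cast (by linarith : (0 : ℝ) < C), fun K => C * ⌈max 1 K⌉₊,
    fun R N hR hN hRN => ?_⟩
  have hN2 : (2 : ℝ) ≤ N := by exact_mod_cast hN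
  have hR1 : (1 : ℝ) ≤ R := by exact_mod_cast hR
  have hR0 : (0 : ℝ) < R := by linarith
  -- For `N² ≤ C` the required probability is not positive and the empty event will do; this leaves
  -- large `N` even when `R = 1`, where `C R log R = 0` imposes nothing.
  rcases le_or_gt ((N : ℝ) ^ 2) C with hNC | hNC
  · refine ⟨∅, MeasurableSet.empty, ?_, fun x hx => absurd hx (Set.notMem_empty x)⟩
    rw [measureReal_empty, sub_nonpos, le_div_iff₀ (by positivity), one_mul]
    exact hNC
  refine ⟨{x | WellSpread (604 * (m * R)) x}, measurableSet_wellSpread _, ?_, fun x hx f hf => ?_⟩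
  · refine le_trans ?_ (real_wellSpread_ge (Q := 604 * (m * R)) (by positivity) hN ?_)
    · gcongr
    · have := mul_log_le_of_mul_log_le (C := C) hA0 (by linarith) (by linarith) hR1
        (by linarith) hRN hNC.le
      push_cast
      rw [hA] at this
      linarith
  obtain ⟨g, hg, huniq, hsup, h2⟩ :=
    leastSquares_of_wellSpread hs hs1 (by omega) hR hm hmW hx hf
  have hF := sobolevNorm_nonneg s f
  refine ⟨g, hg, huniq, fun p hp => ?_⟩
  have hmain := eLpNorm_le_of_rates (mul_nonneg hD0 hF) hR0 hsup h2 hp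
  have hrate : errorConst s * sobolevNorm s f * (R : ℝ) ^ (-s + 1 / 2 - (p⁻¹).toReal) ≤
      C * (R : ℝ) ^ (-s + 1 / 2 - (p⁻¹).toReal) * sobolevNorm s f := by
    rw [mul_right_comm]
    gcongr
    linarith
  refine ⟨hmain.trans (ENNReal.ofReal_le_ofReal hrate), fun K hK => ?_⟩
  refine hmain.trans (ENNReal.ofReal_le_ofReal (hrate.trans ?_))
  have hθ0 : 0 ≤ (p⁻¹).toReal := ENNReal.toReal_nonneg
  have hθ1 : (p⁻¹).toReal ≤ 1 / 2 := by
    have := ENNReal.toReal_mono (by simp) (ENNReal.inv_le_inv.2 hp)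
    simpa using this
  -- The decay exponent `s - 1/2 + 1/p` lies in `[0, 1]`, so the comparison costs at most `max 1 K`,
  -- uniformly in `p`.
  have hcomp := rpow_le_mul_rpow_of_comparable (α := s - 1 / 2 + (p⁻¹).toReal) hC2
    (by
      rcases eq_or_lt_of_le hR with h | h
      · exact Or.inl (by rw [← h]; simp)
      · exact Or.inr (by exact_mod_cast h)) hN2 hRN hK (by linarith) (by linarith)
  rw [show -(s - 1 / 2 + (p⁻¹).toReal) = -s + 1 / 2 - (p⁻¹).toReal by ring] at hcomp
  have hlogN : 0 < Real.log N := Real.log_pos (by linarith)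
  push_cast
  rw [mul_assoc (C : ℝ) (⌈max 1 K⌉₊ : ℝ)]
  gcongr
  refine hcomp.trans ?_
  gcongr
  exact Nat.le_ceil _
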